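/- Let $n\ge 3$ and let $K$ be a field of characteristic $0$ (for example $K=\overline{\mathbf Q}_\ell$). Put $G=\mathrm{GL}_n$, $R=K[x_1,\dots,x_n]$ with each $x_i$ in degree $2$, let $W=S_n$ permute the variables, and let $R^W\cong H^*(\mathbb{B}G)$ be the ring of symmetric polynomials with augmentation ideal $R^W_+$. The Gross motive of $G$ is the graded vector space $\mathbb V=R^W_+/(R^W_+)^2=\bigoplus_d \mathbb V_{2d}$. Let $\mu=(1,1,0,\dots,0)$, $W_\mu=S_2\times S_{n-2}$, $\partial_\mu=\partial_{x_1}+\partial_{x_2}$, and $\eta=(x_1+x_2)^{2n-3}\in R^{W_\mu}\cong H^*(\mathbb{B}P_\mu)$. Here $G/P_\mu$ is the Grassmannian of planes in an $n$-dimensional space, $D_\mu=\dim G/P_\mu=2(n-2)$, and $x_1,x_2$ are the Chern roots of the tautological rank-two subbundle. Let $\int_{G/P_\mu}:R^{W_\mu}\to R^W$ be push-forward along $\mathbb{B}P_\mu\to \mathbb{B}G$, i.e. the unique $R^W$-linear map which lowers degrees by $2D_\mu$ and sends $(x_1x_2)^{n-2}$ (the class of a point on the fibre $G/P_\mu$)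 to $1$. Let $\nabla^\eta_\mu:R^W\to R^W$ be the derivation $f\mapsto\int_{G/P_\mu}\eta\cdot\partial_\mu f$, and let $\overline\nabla^\eta_\mu$ be the graded endomorphism of $\mathbb V$ that it induces. Then the push-forward map exists and is unique as described, $\mathbb V=\bigoplus_{i=1}^n\mathbb V_{2i}$ with each $\mathbb V_{2i}$ ($1\le i\le n$) one-dimensional, and $\overline\nabla^\eta_\mu$ acts on $\mathbb V_{2i}$ as multiplication by the eigenweight $$\epsilon_i(\eta,\mu)=\frac1n\binom{2n-2}{n-1}-\binom{2n-3}{n-i}+2\binom{2n-3}{n-i-1}-\binom{2n-3}{n-i-2},\qquad 1\le i\le n,$$ where $\binom{m}{k}=0$ for $k<0$. -/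

import Mathlib

open MvPolynomial

noncomputable section

namespace GLEigenweight

variable {n : ℕ} (K : Type*) [Field K]

/-- `R^W` for `GL_n`: here `R = K[x_1, …, x_n]` is the (equivariant) cohomology of a point for the
diagonal torus, each `x_i` having cohomological degree `2`, i.e. polynomial degree `1`; the Weyl
group `W = S_n` permutes the variables, and `R^W = H^*(BGL_n)`. -/
abbrev RW (n : ℕ) : Subalgebra K (MvPolynomial (Fin n) K) := symmetricSubalgebra (Fin n) K

/-- `R^{W_μ} = H^*(BP_μ)` for a coweight `μ ∈ ℤ^n`, as an `R^W`-subalgebra of `R`. Here `W_μ` is the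
stabilizer of `μ` in `S_n`. -/
def RWμ (μ : Fin n → ℤ) : Subalgebra (RW K n) (MvPolynomial (Fin n) K) where
  carrier := {f | ∀ w : Equiv.Perm (Fin n), (∀ i, μ (w i) = μ i) → rename w f = f}
  algebraMap_mem' r w _ := r.2 w
  mul_mem' ha hb w hw := by rw [map_mul, ha w hw, hb w hw]
  add_mem' ha hb w hw := by rw [map_add, ha w hw, hb w hw]

set_option synthInstance.maxHeartbeats 200000 in
instance (μ : Fin n → ℤ) : Algebra (RW K n) (RWμ K μ) := inferInstance

instance (μ : Fin n → ℤ) : Module (RW K n) (RWμ K μ) := Algebra.toModule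

instance (μ : Fin n → ℤ) : SMul (RW K n) (RWμ K μ) := Algebra.toSMul

instance : Module (RW K n) (RW K n) := Semiring.toModule

set_option synthInstance.maxHeartbeats 200000 in
instance (μ : Fin n → ℤ) : IsScalarTower K (RW K n) (RWμ K μ) := inferInstance

set_option synthInstance.maxHeartbeats 200000 in
instance (I : Ideal (RW K n)) : Module (RW K n) I := inferInstance

variable {K}

/-- `D_μ = dim G/P_μ`: the number of roots `x_i - x_j` with `⟨x_i - x_j, μ⟩ < 0`. -/
def flagDim (μ : Fin n → ℤ) : ℕ :=
  (Finset.univ.filter fun p : Fin n × Fin n => μ p.1 < μ p.2).card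

/-- The derivation `∂_μ = ∑ μ_i ∂/∂x_i` of `R`. -/
def pderivCoweight (μ : Fin n → ℤ) :
    Derivation K (MvPolynomial (Fin n) K) (MvPolynomial (Fin n) K) :=
  mkDerivation K fun i => C (μ i : K)

theorem rename_pderivCoweight (μ : Fin n → ℤ) (w : Equiv.Perm (Fin n)) (hw : ∀ i, μ (w i) = μ i)
    (f : MvPolynomial (Fin n) K) :
    rename w (pderivCoweight μ f) = pderivCoweight μ (rename w f) := by
  induction f using MvPolynomial.induction_on with
  | C a => simp [pderivCoweight]
  | add p q hp hq => simp [hp, hq]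
  | mul_X p i hp =>
    have hX : ∀ j, pderivCoweight (K := K) μ (X j) = C (μ j : K) := fun j => by
      simp [pderivCoweight]
    simp only [Derivation.leibniz, map_add, map_mul, smul_eq_mul, rename_X, hX, hp, rename_C, hw]

/-- `∂_μ` as a `K`-linear map `R^W → R^{W_μ}`. -/
def pderivLin (μ : Fin n → ℤ) : RW K n →ₗ[K] RWμ K μ where
  toFun f := ⟨pderivCoweight μ f.1, fun w hw => by rw [rename_pderivCoweight μ w hw, f.2 w]⟩
  map_add' f g := Subtype.ext (map_add (pderivCoweight μ) f.1 g.1)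
  map_smul' c f := Subtype.ext ((pderivCoweight μ).map_smul c f.1)

/-- `∂_μ` as a derivation `R^W → R^{W_μ}`. -/
def pderivRW (μ : Fin n → ℤ) : Derivation K (RW K n) (RWμ K μ) :=
  { pderivLin μ with
    map_one_eq_zero' := Subtype.ext (pderivCoweight (K := K) μ).map_one_eq_zero
    leibniz' := fun f g => Subtype.ext ((pderivCoweight μ).leibniz f.1 g.1) }

variable (K) in
/-- The class `∏_i (-x_i)^{#{j : μ_j < μ_i}} ∈ R^{W_μ}`. It restricts to the class of a point on the
fibre `G/P_μ` of `BP_μ → BG`. With `x_i` the Chern roots of the graded pieces of the tautological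
flag, it is a product of top Chern classes of bundles `Hom(gr_a, 𝒪)^{⊕ N_a}`, and sections of these
cut out one reduced point of `G/P_μ`.
For `μ = (1, 0, …, 0)` this is `c_1(𝒪(1))^{n-1}` on `ℙ^{n-1}`, and for `μ = (1, 1, 0, …, 0)` it
is `c_2(S^∨)^{n-2} = (x_1 x_2)^{n-2}` on the Grassmannian of planes with tautological bundle `S`. -/
def pointClass (μ : Fin n → ℤ) : RWμ K μ :=
  ⟨∏ i, (-X i) ^ (Finset.univ.filter fun j => μ j < μ i).card, fun w hw => by
    rw [map_prod]
    refine Fintype.prod_equiv w _ _ fun i => ?_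
    rw [map_pow, map_neg, rename_X, hw]⟩

/-- The characterization of pushforward (fibre integration) along the smooth proper map
`BP_μ → BG` with fibre `G/P_μ`: an `R^W`-linear map `R^{W_μ} → R^W` (projection formula), lowering
the degree by `D_μ = dim G/P_μ` (the cohomological degree by `2 D_μ`), and sending the class of a
point of the fibre to `1`. -/
structure IsFibreIntegral (μ : Fin n → ℤ) (I : RWμ K μ →ₗ[RW K n] RW K n) : Prop where
  eq_zero_of_lt : ∀ (m : ℕ) (f : RWμ K μ), f.1.IsHomogeneous m → m < flagDim μ → I f = 0
  isHomogeneous : ∀ (m : ℕ) (f : RWμ K μ), f.1.IsHomogeneous (m + flagDim μ) →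
    (I f).1.IsHomogeneous m
  point : I (pointClass K μ) = 1

open Classical in
/-- `∫_{G/P_μ} : R^{W_μ} → R^W`, the unique fibre integral (and `0` should there be none). -/
def fibreIntegral (μ : Fin n → ℤ) : RWμ K μ →ₗ[RW K n] RW K n :=
  if h : ∃! I : RWμ K μ →ₗ[RW K n] RW K n, IsFibreIntegral μ I then h.choose else 0

/-- The derivation `∇^η_μ : R^W → R^W`, `f ↦ ∫_{G/P_μ} η · ∂_μ f`. -/
def nabla (μ : Fin n → ℤ) (η : RWμ K μ) : Derivation K (RW K n) (RW K n) :=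
  ((fibreIntegral μ).comp (LinearMap.mulLeft (RW K n) η)).compDer (pderivRW μ)

theorem nabla_apply (μ : Fin n → ℤ) (η : RWμ K μ) (f : RW K n) :
    nabla μ η f = fibreIntegral μ (η * pderivRW μ f) := rfl

variable (K) in
/-- The augmentation ideal `R^W_+` of `R^W`. -/
def augIdeal (n : ℕ) : Ideal (RW K n) :=
  RingHom.ker ((constantCoeff : MvPolynomial (Fin n) K →+* K).comp (RW K n).val.toRingHom)

theorem mem_augIdeal (f : RW K n) : f ∈ augIdeal K n ↔ constantCoeff f.1 = 0 := Iff.rfl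

variable (K) in
/-- The (realization of the) Gross motive `𝕍 = R^W_+ / (R^W_+)^2` of `GL_n`. -/
abbrev GrossMotive (n : ℕ) : Type _ := (augIdeal K n).Cotangent

variable (K) in
/-- The graded piece `𝕍_{2d}`: classes of elements of `R^W_+` that are homogeneous of polynomial
degree `d` in the `x_i`. -/
def grossPiece (n d : ℕ) : Submodule K (GrossMotive K n) :=
  Submodule.map ((augIdeal K n).toCotangent.restrictScalars K)
    (Submodule.comap ((RW K n).val.toLinearMap ∘ₗ ((augIdeal K n).subtype.restrictScalars K))
      (homogeneousSubmodule (Fin n) K d))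

theorem fibreIntegral_constantCoeff (μ : Fin n → ℤ) (m : ℕ) (f : RWμ K μ)
    (hf : f.1.IsHomogeneous m) (hm : m ≠ flagDim μ) :
    constantCoeff (fibreIntegral μ f).1 = 0 := by
  by_cases h : ∃! I : RWμ K μ →ₗ[RW K n] RW K n, IsFibreIntegral μ I
  · have hI : IsFibreIntegral μ (fibreIntegral (K := K) μ) := by
      rw [fibreIntegral, dif_pos h]
      exact h.choose_spec.1
    rcases lt_or_gt_of_ne hm with hlt | hgt
    · rw [hI.eq_zero_of_lt m f hf hlt]; simp
    · obtain ⟨k, rfl⟩ := Nat.exists_eq_add_of_lt hgt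
      have := hI.isHomogeneous (k + 1) f (by convert hf using 1; omega)
      rw [constantCoeff_eq]
      exact this.coeff_eq_zero (by simp)
  · rw [fibreIntegral, dif_neg h]; simp

/-- `∇^η_μ` takes values in `R^W_+` if `η` has degree `2 (D_μ + 1)`. -/
theorem nabla_mem_augIdeal (μ : Fin n → ℤ) (η : RWμ K μ) (hη : η.1.IsHomogeneous (flagDim μ + 1))
    (f : RW K n) : nabla μ η f ∈ augIdeal K n := by
  set g : RWμ K μ := pderivRW μ f with hg
  have hcomp : ∀ m : ℕ, homogeneousComponent m g.1 ∈ RWμ K μ := fun m w hw => by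
    rw [rename_homogeneousComponent, g.2 w hw]
  have hsum : g = ∑ m ∈ Finset.range (g.1.totalDegree + 1),
      (⟨homogeneousComponent m g.1, hcomp m⟩ : RWμ K μ) := by
    apply Subtype.ext
    rw [AddSubmonoidClass.coe_finsetSum]
    exact (sum_homogeneousComponent g.1).symm
  rw [nabla_apply, ← hg, hsum, Finset.mul_sum, map_sum]
  refine Ideal.sum_mem _ fun m _ => ?_
  exact fibreIntegral_constantCoeff μ (flagDim μ + 1 + m) _
    (hη.mul (homogeneousComponent_isHomogeneous m g.1)) (by omega)

/-- The endomorphism `∇̄^η_μ` of the Gross motive induced by `∇^η_μ`, for `η` of degree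
`2 (D_μ + 1)`. -/
def nablaBar (μ : Fin n → ℤ) (η : RWμ K μ) (hη : η.1.IsHomogeneous (flagDim μ + 1)) :
    GrossMotive K n →ₗ[K] GrossMotive K n :=
  Ideal.Cotangent.lift
    (((augIdeal K n).toCotangent.restrictScalars K) ∘ₗ
      (LinearMap.codRestrict ((augIdeal K n).restrictScalars K)
        ((nabla μ η : RW K n →ₗ[K] RW K n) ∘ₗ ((augIdeal K n).subtype.restrictScalars K))
        (fun f => nabla_mem_augIdeal μ η hη f.1)))
    (fun f g => by
      refine (Ideal.toCotangent_eq_zero _ _).2 ?_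
      change nabla μ η (f.1 * g.1) ∈ _
      rw [Derivation.leibniz, pow_two]
      exact Ideal.add_mem _ (Ideal.mul_mem_mul f.2 (nabla_mem_augIdeal μ η hη _))
        (Ideal.mul_mem_mul g.2 (nabla_mem_augIdeal μ η hη _)))

theorem nablaBar_toCotangent (μ : Fin n → ℤ) (η : RWμ K μ)
    (hη : η.1.IsHomogeneous (flagDim μ + 1)) (f : augIdeal K n) :
    nablaBar μ η hη ((augIdeal K n).toCotangent f) =
      (augIdeal K n).toCotangent ⟨nabla μ η f.1, nabla_mem_augIdeal μ η hη f.1⟩ := rfl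

/-- The coweight `(1, 1, 0, …, 0)` of `GL_n`. -/
def coweightTwo (n : ℕ) : Fin n → ℤ := fun i => if (i : ℕ) < 2 then 1 else 0

theorem perm_coweightTwo (n : ℕ) (hn : 3 ≤ n) (w : Equiv.Perm (Fin n))
    (hw : ∀ i, coweightTwo n (w i) = coweightTwo n i) :
    (w ⟨0, by omega⟩ = ⟨0, by omega⟩ ∧ w ⟨1, by omega⟩ = ⟨1, by omega⟩) ∨
      (w ⟨0, by omega⟩ = ⟨1, by omega⟩ ∧ w ⟨1, by omega⟩ = ⟨0, by omega⟩) := by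
  have key : ∀ i : Fin n, (i : ℕ) < 2 → (w i : ℕ) < 2 := fun i hi => by
    by_contra h
    have := hw i
    rw [coweightTwo, coweightTwo, if_neg h, if_pos hi] at this
    exact zero_ne_one this
  have h0 := key ⟨0, by omega⟩ (by simp)
  have h1 := key ⟨1, by omega⟩ (by simp)
  have hne : (w ⟨0, by omega⟩ : ℕ) ≠ w ⟨1, by omega⟩ := fun h => by
    have := w.injective (Fin.ext h)
    simp at this
  simp only [Fin.ext_iff]
  omega

variable (K) in
/-- The polynomial `(x_1 + x_2)^{2n-3}`. -/
def etaPoly (n : ℕ) (hn : 3 ≤ n) : MvPolynomial (Fin n) K :=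
  (X ⟨0, by omega⟩ + X ⟨1, by omega⟩) ^ (2 * n - 3)

theorem etaPoly_mem (n : ℕ) (hn : 3 ≤ n) : etaPoly K n hn ∈ RWμ K (coweightTwo n) := by
  intro w hw
  have h := perm_coweightTwo n hn w hw
  unfold etaPoly
  generalize (⟨0, by omega⟩ : Fin n) = a at *
  generalize (⟨1, by omega⟩ : Fin n) = b at *
  rw [map_pow, map_add, rename_X, rename_X]
  rcases h with ⟨h0, h1⟩ | ⟨h0, h1⟩
  · rw [h0, h1]
  · rw [h0, h1, add_comm]

variable (K) in
/-- The class `η = (x_1 + x_2)^{2n-3}` in `R^{W_μ}`, `μ = (1, 1, 0, …, 0)`. -/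
def etaTwo (n : ℕ) (hn : 3 ≤ n) : RWμ K (coweightTwo n) :=
  ⟨etaPoly K n hn, etaPoly_mem n hn⟩

theorem flagDim_coweightTwo (n : ℕ) (hn : 3 ≤ n) : flagDim (coweightTwo n) + 1 = 2 * n - 3 := by
  obtain ⟨k, rfl⟩ := Nat.exists_eq_add_of_le' (show 2 ≤ n by omega)
  have hset : (Finset.univ.filter fun p : Fin (k + 2) × Fin (k + 2) =>
      coweightTwo (k + 2) p.1 < coweightTwo (k + 2) p.2) =
      (Finset.univ.filter fun i : Fin (k + 2) => ¬ (i : ℕ) < 2) ×ˢ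
        (Finset.univ.filter fun i : Fin (k + 2) => (i : ℕ) < 2) := by
    ext ⟨i, j⟩
    have h : coweightTwo (k + 2) i < coweightTwo (k + 2) j ↔ ¬ (i : ℕ) < 2 ∧ (j : ℕ) < 2 := by
      unfold coweightTwo
      split_ifs with hi hj hj <;> simp [hi, hj]
    simpa only [Finset.mem_filter, Finset.mem_univ, true_and, Finset.mem_product] using h
  have h2 : (Finset.univ.filter fun i : Fin (k + 2) => (i : ℕ) < 2).card = 2 := by
    rw [Fin.card_filter_val_lt]; omega
  have hk : (Finset.univ.filter fun i : Fin (k + 2) => ¬ (i : ℕ) < 2).card = k := by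
    have := Finset.card_filter_add_card_filter_not (s := (Finset.univ : Finset (Fin (k + 2))))
      (fun i : Fin (k + 2) => (i : ℕ) < 2)
    rw [h2, Finset.card_univ, Fintype.card_fin] at this
    omega
  rw [flagDim, hset, Finset.card_product, h2, hk]
  omega

theorem etaTwo_isHomogeneous (n : ℕ) (hn : 3 ≤ n) :
    (etaTwo K n hn).1.IsHomogeneous (flagDim (coweightTwo n) + 1) := by
  rw [flagDim_coweightTwo n hn]
  have := ((isHomogeneous_X K (⟨0, by omega⟩ : Fin n)).add
    (isHomogeneous_X K (⟨1, by omega⟩ : Fin n))).pow (2 * n - 3)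
  rwa [one_mul] at this

/-- The binomial coefficient `C(m, k)` for `k ∈ ℤ`, which is `0` for `k < 0`. -/
def binom (m : ℕ) (k : ℤ) : ℚ := if 0 ≤ k then (m.choose k.toNat : ℚ) else 0

/-- The rational number
`(1/n) C(2n-2, n-1) - C(2n-3, n-i) + 2 C(2n-3, n-i-1) - C(2n-3, n-i-2)`. -/
def eigenweightTwo (n i : ℕ) : ℚ :=
  1 / n * binom (2 * n - 2) (n - 1) - binom (2 * n - 3) (n - i)
    + 2 * binom (2 * n - 3) (n - i - 1) - binom (2 * n - 3) (n - i - 2)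

end GLEigenweight

end

open GLEigenweight

open MvPolynomial

noncomputable section

namespace GLEigenweight

/-! Write n = k + 2 and call the first two variables x_0, x_1. A fibre integral exists because f ↦
A(f (x_0 - x_1) t) / (2 A(δ)) is one, where A is the alternating sum over S_n, δ the staircase
monomial and t its part in the remaining variables; A(δ) is the Vandermonde determinant up to sign,
and it divides every alternating polynomial.

Uniqueness: over R^W the module R^{W_μ} is spanned by s_{a,b} = (x_0^a x_1^b - x_0^b x_1^a)/(x_0 -
x_1) (`span_schurTwo`). Each x_i is a root of a monic polynomial of degree n over R^W, so s_{a,b}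
obeys a linear recurrence in each index. For a, b < n the degree and point axioms fix the integral,
which gives (`fibreIntegral_schurTwo`) ∫ s_{a,b} = H(a) H(b+1) - H(b) H(a+1) with H(n-1+m) = h_m.

The same formula yields the eigenvalues. Expand η ∂_μ p_i binomially into the s_{a,b} and integrate.
A product H(a) H(b) of the relevant degree is indecomposable only if one factor is H(n-1) = 1, the
other then being h_i. Since p_i ≡ i h_i modulo decomposables, ∇p_i is congruent to an integer times
p_i (`mk_nabla_psumRW`), and that integer is the stated binomial expression (`sum_eigenweightTerm`).
In characteristic 0 the classes of p_i and e_i are proportional by a nonzero scalar, and the e_i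
form a basis of 𝕍 because R^W = K[e_1, …, e_n]. -/

variable {n : ℕ} {K : Type*} [Field K]

/-! ### Alternating polynomials and the Vandermonde determinant. -/

section Vandermonde

variable {σ : Type*} [DecidableEq σ]

/-- Modulo X j - X i the substitution x_j ↦ x_i is the identity. -/
theorem X_sub_X_dvd_sub_rename (i j : σ) (F : MvPolynomial σ K) :
    (X j - X i) ∣ F - rename (fun k => if k = j then i else k) F := by
  rw [← Ideal.mem_span_singleton, ← Ideal.Quotient.eq]
  set I : Ideal (MvPolynomial σ K) := Ideal.span {X j - X i}
  have h : Ideal.Quotient.mkₐ K I =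
      (Ideal.Quotient.mkₐ K I).comp (rename (fun k => if k = j then i else k)) := by
    refine MvPolynomial.algHom_ext fun k => ?_
    rw [AlgHom.comp_apply, rename_X]
    split_ifs with hk
    · subst hk
      exact Ideal.Quotient.eq.2 (Ideal.subset_span rfl)
    · rfl
  exact DFunLike.congr_fun h F

/-- Setting x_j = x_i absorbs the swap, so the substituted F equals its own negative and vanishes, 2
being invertible. -/
theorem X_sub_X_dvd_of_swap [CharZero K] {i j : σ} (F : MvPolynomial σ K)
    (hF : rename (Equiv.swap i j) F = -F) : (X j - X i) ∣ F := by
  have h := X_sub_X_dvd_sub_rename (K := K) i j F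
  have h0 : rename (fun k => if k = j then i else k) F = 0 := by
    have h1 : rename (fun k => if k = j then i else k) (rename (Equiv.swap i j) F) =
        rename (fun k => if k = j then i else k) F := by
      rw [rename_rename]
      congr 2
      funext k
      by_cases hi : k = i
      · subst hi; simp
      by_cases hj : k = j
      · subst hj; simp
      · simp [Equiv.swap_apply_of_ne_of_ne hi hj]
    rw [hF, map_neg, neg_eq_iff_add_eq_zero, ← two_mul] at h1
    simpa using h1
  rwa [h0, sub_zero] at h

theorem X_sub_X_ne_zero {σ : Type*} {i j : σ} (h : i ≠ j) : (X j - X i : MvPolynomial σ K) ≠ 0 :=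
  sub_ne_zero.2 fun e => h (X_injective e).symm

theorem irreducible_X_sub_X {i j : σ} (h : i ≠ j) :
    Irreducible (X j - X i : MvPolynomial σ K) := by
  have hhom : (X j - X i : MvPolynomial σ K).IsHomogeneous 1 :=
    (isHomogeneous_X K j).sub (isHomogeneous_X K i)
  refine irreducible_of_totalDegree_eq_one (hhom.totalDegree (X_sub_X_ne_zero h)) fun x hx => ?_
  have h1 := hx (Finsupp.single j 1)
  rw [coeff_sub, coeff_X, coeff_X, if_pos rfl,
    if_neg (by rwa [Finsupp.single_left_inj one_ne_zero]), sub_zero] at h1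
  exact isUnit_of_dvd_one h1

/-- The differences X j - X i with i < j are pairwise non-associate irreducibles, each dividing F;
hence so does their product. -/
theorem vandermonde_dvd_of_alternating [CharZero K] (F : MvPolynomial (Fin n) K)
    (hF : ∀ w : Equiv.Perm (Fin n), rename w F = (Equiv.Perm.sign w : ℤ) • F) :
    (Matrix.vandermonde (X : Fin n → MvPolynomial (Fin n) K)).det ∣ F := by
  have hdvd : ∀ i j : Fin n, i ≠ j → (X j - X i) ∣ F := fun i j hij =>
    X_sub_X_dvd_of_swap F (by rw [hF, Equiv.Perm.sign_swap hij]; simp)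
  rw [Matrix.det_vandermonde, Finset.prod_sigma']
  refine Finset.prod_dvd_of_isRelPrime ?_ ?_
  · rintro ⟨i, j⟩ hij ⟨i', j'⟩ hij' hne
    simp only [Finset.coe_sigma, Set.mem_sigma_iff, Finset.mem_coe, Finset.mem_univ,
      Finset.mem_Ioi, true_and] at hij hij'
    refine ((irreducible_X_sub_X hij.ne).isRelPrime_iff_not_dvd).2 fun hd => hne ?_
    -- Setting x_j = x_i kills the first difference, hence the second; with i < j and i' < j' this
    -- forces the two pairs to agree.
    have h1 := map_dvd (rename (R := K) fun k => if k = j then i else k) hd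
    rw [map_sub, map_sub, rename_X, rename_X, rename_X, rename_X, if_pos rfl, if_neg hij.ne,
      sub_self, zero_dvd_iff, sub_eq_zero] at h1
    have h2 := X_injective h1
    dsimp only at h2 hij hij'
    obtain ⟨rfl, rfl⟩ : i = i' ∧ j = j' := by
      split_ifs at h2 <;> constructor <;> omega
    rfl
  · rintro ⟨i, j⟩ hij
    simp only [Finset.mem_sigma, Finset.mem_univ, Finset.mem_Ioi, true_and] at hij
    exact hdvd i j hij.ne

theorem vandermonde_ne_zero :
    (Matrix.vandermonde (X : Fin n → MvPolynomial (Fin n) K)).det ≠ 0 :=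
  Matrix.det_vandermonde_ne_zero_iff.2 X_injective

/-- The alternating sum `∑ sgn(w) w(f)` over the symmetric group. -/
def alternant (f : MvPolynomial (Fin n) K) : MvPolynomial (Fin n) K :=
  ∑ w : Equiv.Perm (Fin n), (Equiv.Perm.sign w : ℤ) • rename w f

theorem alternant_add (f g : MvPolynomial (Fin n) K) :
    alternant (f + g) = alternant f + alternant g := by
  simp only [alternant, map_add, smul_add, Finset.sum_add_distrib]

theorem alternant_symm_mul (a f : MvPolynomial (Fin n) K) (ha : a.IsSymmetric) :
    alternant (a * f) = a * alternant f := by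
  simp only [alternant, map_mul, ha _, Finset.mul_sum, mul_smul_comm]

theorem rename_alternant (w : Equiv.Perm (Fin n)) (f : MvPolynomial (Fin n) K) :
    rename w (alternant f) = (Equiv.Perm.sign w : ℤ) • alternant f := by
  rw [alternant, map_sum, Finset.smul_sum]
  refine Fintype.sum_equiv (Equiv.mulLeft w) _ _ fun v => ?_
  rw [map_zsmul, rename_rename, Equiv.coe_mulLeft, map_mul, smul_smul, Units.val_mul, ← mul_assoc,
    ← Units.val_mul, Int.units_mul_self, Units.val_one, one_mul, Equiv.Perm.coe_mul]

theorem alternant_rename (w : Equiv.Perm (Fin n)) (f : MvPolynomial (Fin n) K) :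
    alternant (rename w f) = (Equiv.Perm.sign w : ℤ) • alternant f := by
  rw [alternant, alternant, Finset.smul_sum]
  refine Fintype.sum_equiv (Equiv.mulRight w) _ _ fun v => ?_
  rw [rename_rename, Equiv.coe_mulRight, map_mul, smul_smul, Units.val_mul, 
    mul_comm (Equiv.Perm.sign v : ℤ), ← mul_assoc,
    ← Units.val_mul, Int.units_mul_self, Units.val_one, one_mul, Equiv.Perm.coe_mul]

theorem isHomogeneous_alternant {m : ℕ} {f : MvPolynomial (Fin n) K} (hf : f.IsHomogeneous m) :
    (alternant f).IsHomogeneous m :=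
  IsHomogeneous.sum _ _ _ fun w _ => by
    rw [← Int.cast_smul_eq_zsmul K, smul_eq_C_mul]
    exact hf.rename_isHomogeneous.C_mul _

theorem alternant_prod_X_pow :
    alternant (∏ i : Fin n, (X i : MvPolynomial (Fin n) K) ^ (i : ℕ)) =
      (Matrix.vandermonde (X : Fin n → MvPolynomial (Fin n) K)).det := by
  rw [Matrix.det_apply, alternant]
  refine Finset.sum_congr rfl fun w _ => ?_
  rw [map_prod]
  simp only [map_pow, rename_X, Matrix.vandermonde_apply]
  rfl

end Vandermonde

/-! ### Existence of the fibre integral as a quotient of alternants. -/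

theorem isHomogeneous_of_mul_left {σ : Type*} {a b : MvPolynomial σ K} {d m : ℕ}
    (ha : a.IsHomogeneous d) (ha0 : a ≠ 0) (hab : (a * b).IsHomogeneous (d + m)) :
    b.IsHomogeneous m := by
  -- Multiplication by the nonzero form a shifts components by d, so components of b outside degree
  -- m die in a domain.
  have h : ∀ k, homogeneousComponent (d + k) (a * b) = a * homogeneousComponent k b := fun k => by
    let _ : GradedAlgebra (homogeneousSubmodule σ K) := gradedAlgebra
    rw [← decomposition.decompose'_apply, ← decomposition.decompose'_apply]
    exact DirectSum.coe_decompose_mul_add_of_left_mem (homogeneousSubmodule σ K) ha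
  rw [← sum_homogeneousComponent b]
  refine IsHomogeneous.sum _ _ _ fun k _ => ?_
  by_cases hk : k = m
  · exact hk ▸ homogeneousComponent_isHomogeneous k b
  · have h1 := h k
    rw [homogeneousComponent_of_mem hab, if_neg (by omega)] at h1
    rw [(mul_eq_zero.1 h1.symm).resolve_left ha0]
    exact isHomogeneous_zero _ _ _

/-- The staircase monomial `x_1^{n-1} x_2^{n-2} ⋯ x_n^0`. -/
def staircase (K : Type*) [Field K] (n : ℕ) : MvPolynomial (Fin n) K :=
  ∏ i : Fin n, X i ^ (i.rev : ℕ)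

theorem alternant_staircase (K : Type*) [Field K] (n : ℕ) : alternant (staircase K n) =
    (Equiv.Perm.sign (Fin.revPerm : Equiv.Perm (Fin n)) : ℤ) •
      (Matrix.vandermonde (X : Fin n → MvPolynomial (Fin n) K)).det := by
  rw [← alternant_prod_X_pow, ← alternant_rename, map_prod]
  congr 1
  refine Fintype.prod_equiv Fin.revPerm _ _ fun i => ?_
  simp

theorem alternant_staircase_ne_zero (K : Type*) [Field K] (n : ℕ) :
    alternant (staircase K n) ≠ 0 := by
  rw [alternant_staircase]
  rcases Int.units_eq_one_or (Equiv.Perm.sign (Fin.revPerm : Equiv.Perm (Fin n))) with h | h <;>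
    rw [h] <;> simpa using vandermonde_ne_zero

/-- Numerator and denominator both change by sgn(w) under w, so the quotient is symmetric. -/
theorem exists_alternant_eq [CharZero K] (f : MvPolynomial (Fin n) K) :
    ∃ q : RW K n, alternant f = alternant (staircase K n) * q.1 := by
  have hdvd : alternant (staircase K n) ∣ alternant f := by
    have h := vandermonde_dvd_of_alternating (alternant f) fun w => rename_alternant w f
    rw [alternant_staircase]
    rcases Int.units_eq_one_or (Equiv.Perm.sign (Fin.revPerm : Equiv.Perm (Fin n))) with h1 | h1 <;>
      rw [h1] <;> simpa using h
  obtain ⟨q, hq⟩ := hdvd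
  refine ⟨⟨q, fun w => ?_⟩, hq⟩
  have h := rename_alternant w f
  rw [hq, map_mul, rename_alternant, smul_mul_assoc] at h
  rcases Int.units_eq_one_or (Equiv.Perm.sign w) with h1 | h1 <;> rw [h1] at h <;>
    simpa [alternant_staircase_ne_zero] using h

/-- The quotient of the alternant of `f` by the Vandermonde alternant. -/
def alternantQuot [CharZero K] (f : MvPolynomial (Fin n) K) : RW K n :=
  (exists_alternant_eq f).choose

theorem alternantQuot_spec [CharZero K] (f : MvPolynomial (Fin n) K) :
    alternant f = alternant (staircase K n) * (alternantQuot f).1 :=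
  (exists_alternant_eq f).choose_spec

theorem alternantQuot_unique [CharZero K] {f : MvPolynomial (Fin n) K} {q : RW K n}
    (h : alternant f = alternant (staircase K n) * q.1) : alternantQuot f = q :=
  Subtype.ext (mul_left_cancel₀ (alternant_staircase_ne_zero K n)
    ((alternantQuot_spec f).symm.trans h))

theorem pointClass_coweightTwo (k : ℕ) :
    (pointClass K (coweightTwo (k + 2))).1 = (X 0 * X 1) ^ k := by
  have hlt : (Finset.univ.filter fun j : Fin (k + 2) => coweightTwo (k + 2) j < 1).card = k := by
    have h : ∀ j : Fin (k + 2), coweightTwo (k + 2) j < 1 ↔ ¬ ((j : ℕ) < 2) := fun j => by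
      unfold coweightTwo; split_ifs with hj <;> simp [hj]
    simp_rw [h]
    have h1 := Finset.card_filter_add_card_filter_not (s := (Finset.univ : Finset (Fin (k + 2))))
      (fun i : Fin (k + 2) => (i : ℕ) < 2)
    rw [Fin.card_filter_val_lt, Finset.card_univ, Fintype.card_fin] at h1
    omega
  have hle : (Finset.univ.filter fun j : Fin (k + 2) => coweightTwo (k + 2) j < 0).card = 0 := by
    rw [Finset.card_eq_zero, Finset.filter_eq_empty_iff]
    intro j _
    unfold coweightTwo; split_ifs <;> simp
  have h0 : coweightTwo (k + 2) 0 = 1 := rfl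
  have h1 : coweightTwo (k + 2) 1 = 1 := rfl
  have h2 : ∀ i : Fin k, coweightTwo (k + 2) i.succ.succ = 0 := fun i => rfl
  change (∏ i, (-X i) ^ (Finset.univ.filter fun j =>
    coweightTwo (k + 2) j < coweightTwo (k + 2) i).card : MvPolynomial (Fin (k + 2)) K) = _
  rw [Fin.prod_univ_succ, Fin.prod_univ_succ]
  simp only [Fin.succ_zero_eq_one, h0, h1, h2, hlt, hle, pow_zero, Finset.prod_const_one, mul_one]
  rw [← mul_pow, neg_mul_neg]

variable (K) in
/-- The monomial `x_3^{n-3} ⋯ x_n^0` for `n = k + 2`. -/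
def staircaseTail (k : ℕ) : MvPolynomial (Fin (k + 2)) K :=
  ∏ i : Fin k, X i.succ.succ ^ (i.rev : ℕ)

theorem staircase_eq (k : ℕ) :
    staircase K (k + 2) = X 0 ^ (k + 1) * X 1 ^ k * staircaseTail K k := by
  rw [staircase, Fin.prod_univ_succ, Fin.prod_univ_succ, ← mul_assoc, staircaseTail]
  simp [Fin.val_rev]

theorem rename_swap_staircaseTail (k : ℕ) :
    rename (Equiv.swap 0 1) (staircaseTail K k) = staircaseTail K k := by
  rw [staircaseTail, map_prod]
  refine Finset.prod_congr rfl fun i _ => ?_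
  rw [map_pow, rename_X, Equiv.swap_apply_of_ne_of_ne (Fin.succ_ne_zero _)]
  intro h
  rw [← Fin.succ_zero_eq_one] at h
  exact Fin.succ_ne_zero _ (Fin.succ_injective _ h)

variable (K) in
theorem isHomogeneous_staircaseTail (k : ℕ) :
    (staircaseTail K k).IsHomogeneous (∑ i : Fin k, (i.rev : ℕ)) :=
  IsHomogeneous.prod _ _ _ fun i _ => by
    simpa using (isHomogeneous_X K i.succ.succ).pow (i.rev : ℕ)

variable (K) in
theorem isHomogeneous_staircase (k : ℕ) :
    (staircase K (k + 2)).IsHomogeneous (2 * k + 1 + ∑ i : Fin k, (i.rev : ℕ)) := by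
  rw [staircase_eq]
  refine IsHomogeneous.mul ?_ (isHomogeneous_staircaseTail K k)
  convert ((isHomogeneous_X K (0 : Fin (k + 2))).pow (k + 1)).mul
    ((isHomogeneous_X K (1 : Fin (k + 2))).pow k) using 1
  ring

/-- The fibre integral of the Grassmannian of planes as a quotient of alternants. -/
def alternantIntegral [CharZero K] (k : ℕ) :
    RWμ K (coweightTwo (k + 2)) →ₗ[RW K (k + 2)] RW K (k + 2) where
  -- The factor 1/2 compensates for x_0 - x_1, which makes the two orders of x_0, x_1 contribute
  -- equally to the alternant.
  toFun f := algebraMap K (RW K (k + 2)) 2⁻¹ * alternantQuot (f.1 * ((X 0 - X 1) * staircaseTail K k))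
  map_add' f g := by
    rw [← mul_add]
    congr 1
    apply alternantQuot_unique
    change alternant ((f.1 + g.1) * _) = _ * (_ + _)
    rw [add_mul, alternant_add, mul_add, ← alternantQuot_spec, ← alternantQuot_spec]
  map_smul' a f := by
    rw [RingHom.id_apply, smul_eq_mul]
    refine congrArg (algebraMap K (RW K (k + 2)) 2⁻¹ * ·) (alternantQuot_unique (q := a * alternantQuot
      (f.1 * ((X 0 - X 1) * staircaseTail K k))) ?_) |>.trans (mul_left_comm _ a _)
    change alternant ((a.1 * f.1) * _) = _ * (a.1 * _)
    rw [mul_assoc, alternant_symm_mul _ _ a.2, mul_left_comm _ a.1, ← alternantQuot_spec]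

theorem isFibreIntegral_alternantIntegral [CharZero K] (k : ℕ) (hk : 1 ≤ k) :
    IsFibreIntegral (coweightTwo (k + 2)) (alternantIntegral (K := K) k) := by
  have hD : flagDim (coweightTwo (k + 2)) = 2 * k := by
    have := flagDim_coweightTwo (k + 2) (by omega)
    omega
  have hc : ((X 0 - X 1) * staircaseTail K k).IsHomogeneous (1 + ∑ i : Fin k, (i.rev : ℕ)) :=
    ((isHomogeneous_X K 0).sub (isHomogeneous_X K 1)).mul (isHomogeneous_staircaseTail K k)
  have hΔ := isHomogeneous_alternant (isHomogeneous_staircase K k)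
  have hΔ0 := alternant_staircase_ne_zero K (k + 2)
  constructor
  · intro m f hf hm
    rw [hD] at hm
    change algebraMap K (RW K (k + 2)) 2⁻¹ *
      alternantQuot (f.1 * ((X 0 - X 1) * staircaseTail K k)) = 0
    have h1 := isHomogeneous_alternant (hf.mul hc)
    rw [alternantQuot_spec] at h1
    by_contra h
    have hq0 : (alternantQuot (f.1 * ((X 0 - X 1) * staircaseTail K k))).1 ≠ 0 := fun h0 =>
      h (by rw [Subtype.ext (a2 := (0 : RW K (k + 2))) h0, mul_zero])
    have h2 := h1.totalDegree (mul_ne_zero hΔ0 hq0)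
    rw [totalDegree_mul_of_isDomain hΔ0 hq0, hΔ.totalDegree hΔ0] at h2
    omega
  · intro m f hf
    rw [hD] at hf
    change (C 2⁻¹ *
      (alternantQuot (f.1 * ((X 0 - X 1) * staircaseTail K k))).1).IsHomogeneous m
    refine IsHomogeneous.C_mul (isHomogeneous_of_mul_left hΔ hΔ0 ?_) _
    rw [← alternantQuot_spec]
    convert isHomogeneous_alternant (hf.mul hc) using 1
    ring
  · change algebraMap K (RW K (k + 2)) 2⁻¹ * alternantQuot _ = 1
    have h : alternantQuot ((pointClass K (coweightTwo (k + 2))).1 *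
        ((X 0 - X 1) * staircaseTail K k)) = algebraMap K _ 2 := by
      apply alternantQuot_unique
      -- This is the staircase minus its swap under x_0 ↔ x_1; the swap is odd, so both terms
      -- contribute the same alternant and the quotient is 2.
      have h1 : (pointClass K (coweightTwo (k + 2))).1 * ((X 0 - X 1) * staircaseTail K k) =
          staircase K (k + 2) + C (-1) * rename (Equiv.swap 0 1) (staircase K (k + 2)) := by
        rw [pointClass_coweightTwo, staircase_eq, map_mul, rename_swap_staircaseTail, map_mul,
          map_pow, map_pow, rename_X, rename_X, Equiv.swap_apply_left, Equiv.swap_apply_right,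
          map_neg, C_1]
        ring
      rw [h1, alternant_add, alternant_symm_mul _ _ (IsSymmetric.C _), alternant_rename,
        Equiv.Perm.sign_swap (by simp)]
      change _ = _ * (C 2 : MvPolynomial (Fin (k + 2)) K)
      rw [map_neg, C_1, map_ofNat]
      simp
      ring
    rw [h, ← map_mul, inv_mul_cancel₀ two_ne_zero, map_one]

/-! ### Power sums generate the symmetric polynomials in characteristic 0. -/

section PowerSums

variable {σ : Type*} [Fintype σ]

/-- Newton's identity expresses m e_m through lower e_j and power sums; then divide by m. -/
theorem esymm_mem_adjoin_psum [CharZero K] (m : ℕ) :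
    esymm σ K m ∈ Algebra.adjoin K (Set.range (psum σ K)) := by
  induction m using Nat.strong_induction_on with
  | _ m ih =>
    rcases Nat.eq_zero_or_pos m with rfl | hm
    · rw [esymm_zero]
      exact one_mem _
    have hne : (m : K) ≠ 0 := Nat.cast_ne_zero.2 hm.ne'
    have h : esymm σ K m = (m : K)⁻¹ • ((m : MvPolynomial σ K) * esymm σ K m) := by
      rw [← nsmul_eq_mul, ← Nat.cast_smul_eq_nsmul K, smul_smul, inv_mul_cancel₀ hne, one_smul]
    rw [h, mul_esymm_eq_sum]
    refine Subalgebra.smul_mem _ (mul_mem (pow_mem (neg_mem (one_mem _)) _)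
      (sum_mem fun a ha => ?_)) _
    exact mul_mem (mul_mem (pow_mem (neg_mem (one_mem _)) _) (ih _ (Finset.mem_filter.1 ha).2))
      (Algebra.subset_adjoin ⟨_, rfl⟩)

theorem mem_adjoin_psum_of_isSymmetric [CharZero K] {g : MvPolynomial σ K} (hg : g.IsSymmetric) :
    g ∈ Algebra.adjoin K (Set.range (psum σ K)) := by
  obtain ⟨p, hp⟩ := esymmAlgHom_surjective (σ := σ) K le_rfl ⟨g, hg⟩
  have h : g = aeval (fun i : Fin (Fintype.card σ) => esymm σ K (i + 1)) p := by
    rw [← esymmAlgHom_apply, hp]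
  rw [h]
  have h1 : aeval (fun i : Fin (Fintype.card σ) => esymm σ K (i + 1)) p ∈
      Algebra.adjoin K (Set.range fun i : Fin (Fintype.card σ) => esymm σ K (i + 1)) := by
    rw [Algebra.adjoin_range_eq_range_aeval]
    exact ⟨p, rfl⟩
  refine Algebra.adjoin_le ?_ h1
  rintro _ ⟨i, rfl⟩
  exact esymm_mem_adjoin_psum _

end PowerSums

/-! ### Generators of R^{W_μ} as an R^W-module. -/

/-- The permutation of `Fin (k + 2)` fixing `0` and `1` and acting as `σ` on the rest. -/
def permTail {k : ℕ} (σ : Equiv.Perm (Fin k)) : Equiv.Perm (Fin (k + 2)) :=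
  Equiv.Perm.decomposeFin.symm (0, Equiv.Perm.decomposeFin.symm (0, σ))

theorem permTail_zero {k : ℕ} (σ : Equiv.Perm (Fin k)) : permTail σ 0 = 0 := by
  simp [permTail]

theorem permTail_one {k : ℕ} (σ : Equiv.Perm (Fin k)) : permTail σ 1 = 1 := by
  rw [← Fin.succ_zero_eq_one]
  simp [permTail]

theorem permTail_succ_succ {k : ℕ} (σ : Equiv.Perm (Fin k)) (i : Fin k) :
    permTail σ i.succ.succ = (σ i).succ.succ := by
  simp [permTail]

theorem coweightTwo_permTail {k : ℕ} (σ : Equiv.Perm (Fin k)) (i : Fin (k + 2)) :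
    coweightTwo (k + 2) (permTail σ i) = coweightTwo (k + 2) i := by
  refine Fin.cases ?_ (fun i => ?_) i
  · rw [permTail_zero]
  · refine Fin.cases ?_ (fun i => ?_) i
    · rw [Fin.succ_zero_eq_one, permTail_one]
    · rw [permTail_succ_succ]
      rfl

theorem coweightTwo_swap {k : ℕ} (i : Fin (k + 2)) :
    coweightTwo (k + 2) (Equiv.swap 0 1 i) = coweightTwo (k + 2) i := by
  by_cases h0 : i = 0
  · subst h0; rw [Equiv.swap_apply_left]; rfl
  by_cases h1 : i = 1
  · subst h1; rw [Equiv.swap_apply_right]; rfl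
  rw [Equiv.swap_apply_of_ne_of_ne h0 h1]

variable (K) in
/-- `R^W[x_1, x_2]`. -/
def adjoinTwo (k : ℕ) : Subalgebra (RW K (k + 2)) (MvPolynomial (Fin (k + 2)) K) :=
  Algebra.adjoin (RW K (k + 2)) {X 0, X 1}

theorem X_zero_mem_adjoinTwo (k : ℕ) : X 0 ∈ adjoinTwo K k :=
  Algebra.subset_adjoin (Set.mem_insert _ _)

theorem X_one_mem_adjoinTwo (k : ℕ) : X 1 ∈ adjoinTwo K k :=
  Algebra.subset_adjoin (Set.mem_insert_of_mem _ rfl)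

theorem symm_mem_adjoinTwo {k : ℕ} {g : MvPolynomial (Fin (k + 2)) K} (hg : g.IsSymmetric) :
    g ∈ adjoinTwo K k :=
  (adjoinTwo K k).algebraMap_mem ⟨g, hg⟩

/-- Power sums are additive in the variables: those of the tail are p_m - x_0^m - x_1^m, and they
generate all symmetric polynomials of the tail. -/
theorem rename_symm_mem_adjoinTwo [CharZero K] {k : ℕ} {g : MvPolynomial (Fin k) K}
    (hg : g.IsSymmetric) : rename (fun i : Fin k => i.succ.succ) g ∈ adjoinTwo K k := by
  refine Algebra.adjoin_induction
    (p := fun g _ => rename (fun i : Fin k => i.succ.succ) g ∈ adjoinTwo K k)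
    ?_ ?_ ?_ ?_ (mem_adjoin_psum_of_isSymmetric hg)
  · rintro _ ⟨m, rfl⟩
    have h : rename (fun i : Fin k => i.succ.succ) (psum (Fin k) K m) =
        psum (Fin (k + 2)) K m - X 0 ^ m - X 1 ^ m := by
      rw [psum, psum, Fin.sum_univ_succ, Fin.sum_univ_succ, map_sum]
      simp only [map_pow, rename_X, Fin.succ_zero_eq_one]
      ring
    rw [h]
    exact sub_mem (sub_mem (symm_mem_adjoinTwo (psum_isSymmetric _ _ _))
      (pow_mem (X_zero_mem_adjoinTwo k) _)) (pow_mem (X_one_mem_adjoinTwo k) _)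
  · intro c
    rw [AlgHom.commutes]
    exact symm_mem_adjoinTwo (IsSymmetric.C c)
  · intro a b _ _ ha hb
    rw [map_add]
    exact add_mem ha hb
  · intro a b _ _ ha hb
    rw [map_mul]
    exact mul_mem ha hb

/-- A monomial splits into a part in x_0, x_1, which is fixed, and a tail part whose sum over S_k is
symmetric. -/
theorem sum_permTail_mem_adjoinTwo [CharZero K] {k : ℕ} (g : MvPolynomial (Fin (k + 2)) K) :
    ∑ σ : Equiv.Perm (Fin k), rename (permTail σ) g ∈ adjoinTwo K k := by
  induction g using MvPolynomial.induction_on' with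
  | add p q hp hq =>
    simp only [map_add, Finset.sum_add_distrib]
    exact add_mem hp hq
  | monomial s c =>
    set g : MvPolynomial (Fin k) K := C c * ∏ i, X i ^ s i.succ.succ
    have h : monomial s c = X 0 ^ s 0 * X 1 ^ s 1 * rename (fun i : Fin k => i.succ.succ) g := by
      rw [monomial_eq, Finsupp.prod_fintype _ _ fun i => pow_zero _, Fin.prod_univ_succ,
        Fin.prod_univ_succ, map_mul, map_prod, rename_C]
      simp only [map_pow, rename_X, Fin.succ_zero_eq_one]
      ring
    have h1 : ∀ σ : Equiv.Perm (Fin k), rename (permTail σ) (monomial s c) =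
        X 0 ^ s 0 * X 1 ^ s 1 * rename (fun i : Fin k => i.succ.succ) (rename σ g) := fun σ => by
      rw [h, map_mul, map_mul, map_pow, map_pow, rename_X, rename_X, permTail_zero, permTail_one,
        rename_rename, rename_rename]
      congr 3
    simp only [h1]
    rw [← Finset.mul_sum, ← map_sum]
    refine mul_mem (mul_mem (pow_mem (X_zero_mem_adjoinTwo k) _)
      (pow_mem (X_one_mem_adjoinTwo k) _)) (rename_symm_mem_adjoinTwo fun τ => ?_)
    rw [map_sum]
    refine Fintype.sum_equiv (Equiv.mulLeft τ) _ _ fun σ => ?_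
    rw [rename_rename, Equiv.coe_mulLeft, Equiv.Perm.coe_mul]

/-- An invariant equals its average over the permutations of the tail. -/
theorem mem_adjoinTwo [CharZero K] {k : ℕ} (f : RWμ K (coweightTwo (k + 2))) :
    f.1 ∈ adjoinTwo K k := by
  have h := sum_permTail_mem_adjoinTwo f.1
  have h1 : ∀ σ : Equiv.Perm (Fin k), rename (permTail σ) f.1 = f.1 := fun σ =>
    f.2 _ (coweightTwo_permTail σ)
  simp only [h1, Finset.sum_const, Finset.card_univ] at h
  have hne : (Fintype.card (Equiv.Perm (Fin k)) : K) ≠ 0 := Nat.cast_ne_zero.2 Fintype.card_ne_zero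
  have h2 : f.1 = C (Fintype.card (Equiv.Perm (Fin k)) : K)⁻¹ *
      (Fintype.card (Equiv.Perm (Fin k)) • f.1) := by
    rw [← Nat.cast_smul_eq_nsmul K, smul_eq_C_mul, ← mul_assoc, ← C_mul, inv_mul_cancel₀ hne, C_1,
      one_mul]
  rw [h2]
  exact mul_mem (symm_mem_adjoinTwo (IsSymmetric.C _)) h

/-- The numerator is antisymmetric in x_0, x_1. An element of W_μ fixes or exchanges these two
variables, so it changes numerator and denominator by the same sign. -/
theorem exists_schurTwo [CharZero K] {k : ℕ} (hk : 1 ≤ k) (a b : ℕ) :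
    ∃ s : RWμ K (coweightTwo (k + 2)), (X 0 - X 1) * s.1 = X 0 ^ a * X 1 ^ b - X 0 ^ b * X 1 ^ a := by
  have h01 : (1 : Fin (k + 2)) ≠ 0 := by simp
  obtain ⟨q, hq⟩ : (X 0 - X 1 : MvPolynomial (Fin (k + 2)) K) ∣
      X 0 ^ a * X 1 ^ b - X 0 ^ b * X 1 ^ a := by
    refine X_sub_X_dvd_of_swap _ ?_
    simp only [map_sub, map_mul, map_pow, rename_X, Equiv.swap_apply_left, Equiv.swap_apply_right]
    ring
  refine ⟨⟨q, fun w hw => ?_⟩, hq.symm⟩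
  have h := congrArg (rename w) hq
  simp only [map_sub, map_mul, map_pow, rename_X] at h
  refine mul_left_cancel₀ (X_sub_X_ne_zero h01) ?_
  rcases perm_coweightTwo (k + 2) (by omega) w hw with ⟨h0, h1⟩ | ⟨h0, h1⟩
  · replace h0 : w 0 = 0 := h0
    replace h1 : w 1 = 1 := h1
    rw [h0, h1] at h
    rw [← h, hq]
  · replace h0 : w 0 = 1 := h0
    replace h1 : w 1 = 0 := h1
    rw [h0, h1] at h
    linear_combination h + hq

/-- The quotient `(x_1^a x_2^b - x_1^b x_2^a) / (x_1 - x_2)`, a Schur polynomial up to sign. -/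
def schurTwo [CharZero K] {k : ℕ} (hk : 1 ≤ k) (a b : ℕ) : RWμ K (coweightTwo (k + 2)) :=
  (exists_schurTwo hk a b).choose

theorem mul_schurTwo [CharZero K] {k : ℕ} (hk : 1 ≤ k) (a b : ℕ) :
    (X 0 - X 1) * (schurTwo (K := K) hk a b).1 = X 0 ^ a * X 1 ^ b - X 0 ^ b * X 1 ^ a :=
  (exists_schurTwo hk a b).choose_spec

theorem ext_of_mul {k : ℕ} {f g : RWμ K (coweightTwo (k + 2))}
    (h : (X 0 - X 1) * f.1 = (X 0 - X 1) * g.1) : f = g :=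
  Subtype.ext (mul_left_cancel₀ (X_sub_X_ne_zero (by simp)) h)

/-- Antisymmetrising is R^W-linear and sends x_0^a x_1^b to the numerator of `schurTwo`. -/
theorem exists_mul_eq_sub_swap [CharZero K] {k : ℕ} (hk : 1 ≤ k)
    {g : MvPolynomial (Fin (k + 2)) K} (hg : g ∈ adjoinTwo K k) :
    ∃ s ∈ Submodule.span (RW K (k + 2))
      (Set.range fun p : ℕ × ℕ => schurTwo (K := K) hk p.1 p.2),
      (X 0 - X 1) * s.1 = g - rename (Equiv.swap 0 1) g := by
  rw [adjoinTwo, ← Subalgebra.mem_toSubmodule, Algebra.adjoin_eq_span] at hg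
  induction hg using Submodule.span_induction with
  | mem x hx =>
    obtain ⟨a, b, rfl⟩ := (Submonoid.mem_closure_pair _ _ _).1 hx
    refine ⟨_, Submodule.subset_span ⟨(a, b), rfl⟩, ?_⟩
    rw [mul_schurTwo]
    simp only [map_mul, map_pow, rename_X, Equiv.swap_apply_left, Equiv.swap_apply_right]
    ring
  | zero => exact ⟨0, zero_mem _, by simp⟩
  | add x y _ _ hx hy =>
    obtain ⟨s, hs, h1⟩ := hx
    obtain ⟨t, ht, h2⟩ := hy
    refine ⟨s + t, add_mem hs ht, ?_⟩
    change _ * (s.1 + t.1) = _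
    rw [map_add]
    linear_combination h1 + h2
  | smul a x _ hx =>
    obtain ⟨s, hs, h1⟩ := hx
    refine ⟨a • s, Submodule.smul_mem _ _ hs, ?_⟩
    change _ * (a.1 * s.1) = a.1 * x - rename _ (a.1 * x)
    rw [map_mul, a.2]
    linear_combination a.1 * h1

theorem span_schurTwo [CharZero K] {k : ℕ} (hk : 1 ≤ k) :
    Submodule.span (RW K (k + 2))
      (Set.range fun p : ℕ × ℕ => schurTwo (K := K) hk p.1 p.2) = ⊤ := by
  refine eq_top_iff.2 fun f _ => ?_
  -- For f invariant under the swap, antisymmetrising (x_0 - x_1) f gives 2 (x_0 - x_1) f, so f is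
  -- half of s.
  obtain ⟨s, hs, h⟩ := exists_mul_eq_sub_swap hk
    (mul_mem (Subalgebra.sub_mem _ (X_zero_mem_adjoinTwo (K := K) k) (X_one_mem_adjoinTwo k))
      (mem_adjoinTwo f))
  have hf : f = algebraMap K (RW K (k + 2)) 2⁻¹ • s := by
    refine ext_of_mul ?_
    change _ = _ * (C 2⁻¹ * s.1)
    rw [mul_left_comm, h, map_mul, f.2 _ coweightTwo_swap]
    simp only [map_sub, rename_X, Equiv.swap_apply_left, Equiv.swap_apply_right]
    have h2 : (C 2⁻¹ : MvPolynomial (Fin (k + 2)) K) * 2 = 1 := by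
      rw [← map_ofNat C 2, ← C_mul, inv_mul_cancel₀ two_ne_zero, C_1]
    linear_combination -(X 0 - X 1) * f.1 * h2
  rw [hf]
  exact Submodule.smul_mem _ _ hs

/-! ### The linear recurrence satisfied by the variables. -/

/-- The elementary symmetric polynomial `e_j` as an element of `R^W`. -/
def esymmRW (K : Type*) [Field K] (n : ℕ) (j : ℕ) : RW K n :=
  ⟨esymm (Fin n) K j, esymm_isSymmetric _ _ _⟩

/-- The linear recurrence with characteristic polynomial `∏ (t - x_i)`. -/
def esymmRecurrence (K : Type*) [Field K] (n : ℕ) : LinearRecurrence (RW K n) where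
  order := n
  coeffs i := (-1) ^ (i.rev : ℕ) * esymmRW K n (i.rev + 1)

theorem X_pow_recurrence (i : Fin n) (m : ℕ) :
    (X i : MvPolynomial (Fin n) K) ^ (m + n) =
      ∑ j, ((esymmRecurrence K n).coeffs j).1 * X i ^ (m + j) := by
  -- ∏ (x_j + t) vanishes at t = -x_i; the rest is sign bookkeeping.
  have h := congrArg (Polynomial.eval (-X i)) (MvPolynomial.prod_C_add_X_eq_sum_esymm K (Fin n))
  rw [Polynomial.eval_prod, Finset.prod_eq_zero (Finset.mem_univ i) (by simp),
    Polynomial.eval_finsetSum, Fintype.card_fin, Finset.sum_range_succ'] at h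
  simp only [Polynomial.eval_mul, Polynomial.eval_C, Polynomial.eval_pow, Polynomial.eval_X,
    esymm_zero, one_mul, Nat.sub_zero] at h
  have h1 : ∑ j, ((esymmRecurrence K n).coeffs j).1 * X i ^ (m + j) =
      X i ^ m * ∑ j ∈ Finset.range n, (-1) ^ j * esymm (Fin n) K (j + 1) * X i ^ (n - (j + 1)) := by
    change ∑ j : Fin n, ((-1) ^ (j.rev : ℕ) * esymm (Fin n) K (j.rev + 1)) * X i ^ (m + (j : ℕ)) = _
    rw [← Fin.sum_univ_eq_sum_range (fun j => (-1) ^ j * esymm (Fin n) K (j + 1) *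
      (X i : MvPolynomial (Fin n) K) ^ (n - (j + 1))) n, Finset.mul_sum]
    refine Fintype.sum_equiv Fin.revPerm _ _ fun j => ?_
    have hj : n - ((j.rev : ℕ) + 1) = j := by rw [Fin.val_rev]; omega
    rw [Fin.revPerm_apply, hj, pow_add]
    ring
  rw [h1, pow_add]
  congr 1
  have h2 : ∀ j ∈ Finset.range n, esymm (Fin n) K (j + 1) * (-X i) ^ (n - (j + 1)) =
      -(-1) ^ n * ((-1) ^ j * esymm (Fin n) K (j + 1) * X i ^ (n - (j + 1))) := fun j hj => by
    obtain ⟨d, rfl⟩ := Nat.exists_eq_add_of_lt (Finset.mem_range.1 hj)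
    have hd : j + d + 1 - (j + 1) = d := by omega
    have hs : ((-1 : MvPolynomial (Fin (j + d + 1)) K) ^ j) * (-1) ^ j = 1 := by
      rw [← mul_pow]; simp
    rw [hd, neg_pow, pow_succ, pow_add]
    linear_combination (-esymm (Fin (j + d + 1)) K (j + 1) * (-1) ^ d * X i ^ d) * hs
  have hs : ((-1 : MvPolynomial (Fin n) K) ^ n) * (-1) ^ n = 1 := by
    rw [← mul_pow]; simp
  rw [Finset.sum_congr rfl h2, ← Finset.mul_sum, neg_pow] at h
  linear_combination (-(-1) ^ n) * h + (X i ^ n -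
    ∑ j ∈ Finset.range n, (-1) ^ j * esymm (Fin n) K (j + 1) * X i ^ (n - (j + 1))) * -hs

/-- The sequence `H(m)` with generating recurrence `esymmRecurrence`, vanishing for `m < n - 1` and
with `H(n - 1) = 1`. In other words `H(n - 1 + m)` is the complete symmetric polynomial `h_m`. -/
def hseq (K : Type*) [Field K] (n : ℕ) : ℕ → RW K n :=
  (esymmRecurrence K n).mkSol fun i => if (i : ℕ) + 1 = n then 1 else 0

theorem hseq_isSolution : (esymmRecurrence K n).IsSolution (hseq K n) :=
  (esymmRecurrence K n).is_sol_mkSol _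

theorem hseq_of_lt {m : ℕ} (hm : m < n) : hseq K n m = if m + 1 = n then 1 else 0 :=
  (esymmRecurrence K n).mkSol_eq_init (fun i => if (i : ℕ) + 1 = n then 1 else 0) ⟨m, hm⟩

theorem hseq_eq_zero {m : ℕ} (hm : m + 1 < n) : hseq K n m = 0 := by
  rw [hseq_of_lt (by omega), if_neg (by omega)]

theorem hseq_eq_one {m : ℕ} (hm : m + 1 = n) : hseq K n m = 1 := by
  rw [hseq_of_lt (by omega), if_pos hm]

section Recurrence

variable {R : Type*} [CommRing R] {E : LinearRecurrence R}

theorem IsSolution_eq_of_eq {u v : ℕ → R} (hu : E.IsSolution u) (hv : E.IsSolution v)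
    (h : ∀ m < E.order, u m = v m) : u = v :=
  (E.eq_iff_eqOn_range_order u v hu hv).2 fun m hm => h m (by simpa using hm)

theorem IsSolution_shift {u : ℕ → R} (hu : E.IsSolution u) : E.IsSolution fun m => u (m + 1) :=
  fun m => by
    have h := hu (m + 1)
    simp only [add_right_comm] at h ⊢
    exact h

theorem IsSolution_mul_sub {u v : ℕ → R} (hu : E.IsSolution u) (hv : E.IsSolution v) (c d : R) :
    E.IsSolution fun m => u m * c - d * v m := fun m => by
  simp only [hu m, hv m, Finset.sum_mul, Finset.mul_sum, ← Finset.sum_sub_distrib]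
  exact Finset.sum_congr rfl fun i _ => by ring

end Recurrence

/-! ### Uniqueness of the fibre integral and its value on the spanning set. -/

section FibreIntegral

variable [CharZero K] {k : ℕ} (hk : 1 ≤ k)

theorem schurTwo_add_swap (a b : ℕ) : schurTwo (K := K) hk b a + schurTwo hk a b = 0 := by
  refine ext_of_mul ?_
  change _ * ((schurTwo hk b a).1 + (schurTwo hk a b).1) = _ * 0
  rw [mul_add, mul_schurTwo, mul_schurTwo]
  ring

theorem isHomogeneous_schurTwo {a b m : ℕ} (h : a + b = m + 1) :
    (schurTwo (K := K) hk a b).1.IsHomogeneous m := by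
  have h01 : (1 : Fin (k + 2)) ≠ 0 := by simp
  refine isHomogeneous_of_mul_left ((isHomogeneous_X K 0).sub (isHomogeneous_X K 1))
    (X_sub_X_ne_zero h01) ?_
  rw [mul_schurTwo]
  have hX : ∀ a b : ℕ, a + b = 1 + m →
      (X 0 ^ a * X 1 ^ b : MvPolynomial (Fin (k + 2)) K).IsHomogeneous (1 + m) := fun a b h => by
    simpa [h] using ((isHomogeneous_X K (0 : Fin (k + 2))).pow a).mul
      ((isHomogeneous_X K (1 : Fin (k + 2))).pow b)
  exact (hX a b (by omega)).sub (hX b a (by omega))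

theorem schurTwo_top : schurTwo (K := K) hk (k + 1) k = pointClass K (coweightTwo (k + 2)) := by
  refine ext_of_mul ?_
  rw [mul_schurTwo, pointClass_coweightTwo]
  ring

/-- The powers of x_0 and of x_1 obey the same recurrence with symmetric coefficients, so the
numerator does too. -/
theorem schurTwo_recurrence (b m : ℕ) : schurTwo (K := K) hk (m + (k + 2)) b =
    ∑ j, (esymmRecurrence K (k + 2)).coeffs j • schurTwo (K := K) hk (m + j) b := by
  refine ext_of_mul ?_
  rw [AddSubmonoidClass.coe_finsetSum, Finset.mul_sum, mul_schurTwo, X_pow_recurrence,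
    X_pow_recurrence, Finset.sum_mul, Finset.mul_sum, ← Finset.sum_sub_distrib]
  refine Finset.sum_congr rfl fun j _ => ?_
  change _ = _ * (((esymmRecurrence K (k + 2)).coeffs j).1 * (schurTwo hk (m + j) b).1)
  linear_combination -((esymmRecurrence K (k + 2)).coeffs j).1 * mul_schurTwo (K := K) hk (m + j) b

/-- The degree a + b - 1 is below 2k, where the integral vanishes, except for (a, b) = (k + 1, k),
which is the point class. The right side has the same values because H vanishes below k + 1. -/
theorem fibreIntegral_schurTwo_of_lt
    {I : RWμ K (coweightTwo (k + 2)) →ₗ[RW K (k + 2)] RW K (k + 2)}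
    (hI : IsFibreIntegral (coweightTwo (k + 2)) I) {a b : ℕ} (hba : b < a) (ha : a < k + 2) :
    I (schurTwo hk a b) = hseq K (k + 2) a * hseq K (k + 2) (b + 1) -
      hseq K (k + 2) b * hseq K (k + 2) (a + 1) := by
  have hD : flagDim (coweightTwo (k + 2)) = 2 * k := by
    have := flagDim_coweightTwo (k + 2) (by omega)
    omega
  have hb0 : hseq K (k + 2) b = 0 := hseq_eq_zero (by omega)
  rw [hb0, zero_mul, sub_zero]
  by_cases hb : b = k
  · obtain rfl : a = k + 1 := by omega
    subst hb
    rw [schurTwo_top, hI.point, hseq_eq_one rfl, one_mul]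
  · have h0 : hseq K (k + 2) (b + 1) = 0 := hseq_eq_zero (by omega)
    rw [h0, mul_zero]
    exact hI.eq_zero_of_lt (a + b - 1) _ (isHomogeneous_schurTwo hk (by omega)) (by omega)

/-- The Jacobi–Trudi type formula for the fibre integral of a two-row Schur polynomial. -/
theorem fibreIntegral_schurTwo
    {I : RWμ K (coweightTwo (k + 2)) →ₗ[RW K (k + 2)] RW K (k + 2)}
    (hI : IsFibreIntegral (coweightTwo (k + 2)) I) (a b : ℕ) :
    I (schurTwo hk a b) = hseq K (k + 2) a * hseq K (k + 2) (b + 1) -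
      hseq K (k + 2) b * hseq K (k + 2) (a + 1) := by
  have hrec : ∀ b, (esymmRecurrence K (k + 2)).IsSolution fun a => I (schurTwo hk a b) :=
    fun b m => by
      change I (schurTwo hk (m + (k + 2)) b) = _
      rw [schurTwo_recurrence, map_sum]
      exact Finset.sum_congr rfl fun j _ => map_smul I _ _
  have hsol : ∀ b, (esymmRecurrence K (k + 2)).IsSolution fun a =>
      hseq K (k + 2) a * hseq K (k + 2) (b + 1) - hseq K (k + 2) b * hseq K (k + 2) (a + 1) :=
    fun b => IsSolution_mul_sub hseq_isSolution (IsSolution_shift hseq_isSolution) _ _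
  have hanti : ∀ {a b}, I (schurTwo hk a b) = hseq K (k + 2) a * hseq K (k + 2) (b + 1) -
      hseq K (k + 2) b * hseq K (k + 2) (a + 1) → I (schurTwo hk b a) =
      hseq K (k + 2) b * hseq K (k + 2) (a + 1) - hseq K (k + 2) a * hseq K (k + 2) (b + 1) :=
    fun {a b} h => by
      have h1 := congrArg I (schurTwo_add_swap hk a b)
      rw [map_add, map_zero, h] at h1
      linear_combination h1
  have hsmall : ∀ a < k + 2, ∀ b < k + 2, I (schurTwo hk a b) =
      hseq K (k + 2) a * hseq K (k + 2) (b + 1) - hseq K (k + 2) b * hseq K (k + 2) (a + 1) := by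
    intro a ha b hb
    rcases lt_trichotomy a b with h | rfl | h
    · exact hanti (fibreIntegral_schurTwo_of_lt hk hI h hb)
    · have h0 : schurTwo (K := K) hk a a = 0 :=
        ext_of_mul (by rw [mul_schurTwo]; simp)
      rw [h0, map_zero, sub_self]
    · exact fibreIntegral_schurTwo_of_lt hk hI h ha
  -- For fixed b both sides solve the recurrence of order k + 2 in a, so agreement on initial values
  -- suffices.
  have hmid : ∀ b < k + 2, ∀ a, I (schurTwo hk a b) =
      hseq K (k + 2) a * hseq K (k + 2) (b + 1) - hseq K (k + 2) b * hseq K (k + 2) (a + 1) :=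
    fun b hb => congrFun (IsSolution_eq_of_eq (hrec b) (hsol b) fun a ha => hsmall a ha b hb)
  -- For arbitrary b the initial values in a come from `hmid` with the indices exchanged by
  -- antisymmetry.
  exact congrFun (IsSolution_eq_of_eq (hrec b) (hsol b) fun a ha => hanti (hmid a ha b)) a

/-- The axioms force values on the spanning set `schurTwo` that do not depend on the integral. -/
theorem existsUnique_isFibreIntegral {k : ℕ} (hk : 1 ≤ k) :
    ∃! I : RWμ K (coweightTwo (k + 2)) →ₗ[RW K (k + 2)] RW K (k + 2),
      IsFibreIntegral (coweightTwo (k + 2)) I := by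
  refine ⟨alternantIntegral k, isFibreIntegral_alternantIntegral k hk, fun I hI => ?_⟩
  refine LinearMap.ext_on_range (span_schurTwo hk) fun p => ?_
  rw [fibreIntegral_schurTwo hk hI,
    fibreIntegral_schurTwo hk (isFibreIntegral_alternantIntegral k hk)]

theorem isFibreIntegral_fibreIntegral {k : ℕ} (hk : 1 ≤ k) :
    IsFibreIntegral (coweightTwo (k + 2)) (fibreIntegral (K := K) (coweightTwo (k + 2))) := by
  rw [fibreIntegral, dif_pos (existsUnique_isFibreIntegral hk)]
  exact (existsUnique_isFibreIntegral hk).choose_spec.1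

end FibreIntegral

/-! ### The Gross motive and its basis of elementary symmetric classes. -/

theorem isHomogeneous_esymm (σ : Type*) [Fintype σ] (j : ℕ) : (esymm σ K j).IsHomogeneous j :=
  IsHomogeneous.sum _ _ _ fun s hs => by
    have h := IsHomogeneous.prod s (fun i => (X i : MvPolynomial σ K)) (fun _ => 1)
      fun i _ => isHomogeneous_X K i
    simpa [(Finset.mem_powersetCard.1 hs).2] using h

theorem isHomogeneous_psum (σ : Type*) [Fintype σ] (j : ℕ) : (psum σ K j).IsHomogeneous j :=
  IsHomogeneous.sum _ _ _ fun i _ => by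
    simpa using (isHomogeneous_X K i).pow j

theorem mem_augIdeal_of_isHomogeneous {f : RW K n} {d : ℕ} (hd : d ≠ 0)
    (hf : f.1.IsHomogeneous d) : f ∈ augIdeal K n := by
  rw [mem_augIdeal, constantCoeff_eq]
  exact hf.coeff_eq_zero (by simpa using hd.symm)

theorem esymmRW_mem_augIdeal {j : ℕ} (hj : j ≠ 0) : esymmRW K n j ∈ augIdeal K n :=
  mem_augIdeal_of_isHomogeneous hj (isHomogeneous_esymm _ _)

theorem esymmRW_eq_zero {j : ℕ} (hj : n < j) : esymmRW K n j = 0 := by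
  refine Subtype.ext ?_
  change esymm (Fin n) K j = 0
  rw [esymm, Finset.powersetCard_eq_empty.2 (by simpa using hj), Finset.sum_empty]

/-- The class of `e_{i + 1}` in the Gross motive. -/
def esymmClass (K : Type*) [Field K] (n : ℕ) (i : ℕ) : GrossMotive K n :=
  (augIdeal K n).toCotangent ⟨esymmRW K n (i + 1), esymmRW_mem_augIdeal i.succ_ne_zero⟩

/-- `R^W` as the polynomial ring in the elementary symmetric polynomials. -/
abbrev esymmEquiv (K : Type*) [Field K] (n : ℕ) : MvPolynomial (Fin n) K ≃ₐ[K] RW K n :=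
  esymmAlgEquiv (Fin n) K (Fintype.card_fin n)

theorem esymmEquiv_X (i : Fin n) : esymmEquiv K n (X i) = esymmRW K n (i + 1) := by
  refine Subtype.ext ?_
  change (esymmAlgHom (Fin n) K n (X i)).1 = esymm (Fin n) K (i + 1)
  rw [esymmAlgHom_apply, aeval_X]

theorem constantCoeff_esymmEquiv (g : MvPolynomial (Fin n) K) :
    constantCoeff (esymmEquiv K n g).1 = constantCoeff g := by
  induction g using MvPolynomial.induction_on with
  | C a =>
    have h : esymmEquiv K n (C a) = algebraMap K (RW K n) a := (esymmEquiv K n).commutes a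
    rw [h]
    rfl
  | add p q hp hq =>
    rw [map_add, map_add, ← hp, ← hq]
    exact map_add constantCoeff _ _
  | mul_X p i hp =>
    rw [map_mul, esymmEquiv_X, map_mul, constantCoeff_X, mul_zero]
    change constantCoeff (_ * esymm (Fin n) K (i + 1)) = 0
    have h : constantCoeff (esymm (Fin n) K (i + 1)) = 0 :=
      esymmRW_mem_augIdeal (Nat.succ_ne_zero i)
    rw [map_mul, h, mul_zero]

/-- The coefficient of `e_{i + 1}` in a symmetric polynomial. -/
def esymmCoeff (i : Fin n) : RW K n →ₗ[K] K where
  toFun f := constantCoeff (pderiv i ((esymmEquiv K n).symm f))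
  map_add' f g := by simp only [map_add]
  map_smul' c f := by simp [smul_eq_C_mul]

theorem esymmCoeff_esymmRW (i j : Fin n) :
    esymmCoeff i (esymmRW K n (j + 1)) = if i = j then 1 else 0 := by
  change constantCoeff (pderiv i ((esymmEquiv K n).symm (esymmRW K n (j + 1)))) = _
  rw [← esymmEquiv_X, AlgEquiv.symm_apply_apply, pderiv_X, Pi.single_apply]
  split_ifs <;> simp_all

/-- By Leibniz, a first derivative of a product of two polynomials without constant term vanishes at
the origin. Hence these functionals descend to 𝕍, where they are dual to the classes of the e_i. -/
theorem esymmCoeff_eq_zero (i : Fin n) {f : RW K n} (hf : f ∈ augIdeal K n ^ 2) :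
    esymmCoeff i f = 0 := by
  rw [pow_two] at hf
  have h0 : ∀ a ∈ augIdeal K n, constantCoeff ((esymmEquiv K n).symm a) = 0 := fun a ha => by
    rw [← constantCoeff_esymmEquiv, AlgEquiv.apply_symm_apply]
    exact ha
  refine Submodule.mul_induction_on hf (fun a ha b hb => ?_) fun a b ha hb => by
    rw [map_add, ha, hb, add_zero]
  change constantCoeff (pderiv i ((esymmEquiv K n).symm (a * b))) = 0
  rw [map_mul, Derivation.leibniz, map_add, smul_eq_mul, smul_eq_mul, map_mul, map_mul, h0 a ha,
    h0 b hb, zero_mul, zero_mul, add_zero]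

theorem toCotangent_eq_smul {f g : augIdeal K n} {c : K}
    (h : f.1 - c • g.1 ∈ augIdeal K n ^ 2) :
    (augIdeal K n).toCotangent f = c • (augIdeal K n).toCotangent g := by
  have h1 : (augIdeal K n).toCotangent f = (augIdeal K n).toCotangent (c • g) :=
    ((augIdeal K n).toCotangent_eq).2 h
  rw [h1]
  exact map_smul ((augIdeal K n).toCotangent.restrictScalars K) c g

theorem linearIndependent_esymmClass :
    LinearIndependent K fun i : Fin n => esymmClass K n i := by
  rw [Fintype.linearIndependent_iff]
  intro c hc i
  have h : (augIdeal K n).toCotangent (∑ j : Fin n, c j •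
      (⟨esymmRW K n (j + 1), esymmRW_mem_augIdeal (Nat.succ_ne_zero j)⟩ : augIdeal K n)) = 0 := by
    rw [← hc, map_sum]
    exact Finset.sum_congr rfl fun j _ =>
      map_smul ((augIdeal K n).toCotangent.restrictScalars K) _ _
  have h1 := esymmCoeff_eq_zero i ((Ideal.toCotangent_eq_zero _ _).1 h)
  have h2 : (∑ j : Fin n, c j • (⟨esymmRW K n (j + 1),
      esymmRW_mem_augIdeal (Nat.succ_ne_zero j)⟩ : augIdeal K n)).1 =
      ∑ j : Fin n, c j • esymmRW K n (j + 1) := by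
    rw [AddSubmonoidClass.coe_finsetSum]
    rfl
  rw [h2, map_sum] at h1
  simpa [esymmCoeff_esymmRW] using h1

/-- The degree `d` component of a symmetric polynomial. -/
def componentRW (d : ℕ) (f : RW K n) : RW K n :=
  ⟨homogeneousComponent d f.1, fun w => by rw [rename_homogeneousComponent, f.2 w]⟩

theorem componentRW_of_isHomogeneous {f : RW K n} {m : ℕ} (hf : f.1.IsHomogeneous m) (d : ℕ) :
    componentRW d f = if d = m then f else 0 := by
  refine Subtype.ext ?_
  change homogeneousComponent d f.1 = _
  rw [homogeneousComponent_of_mem hf]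
  split_ifs <;> rfl

theorem isHomogeneous_esymmEquiv_monomial (s : Fin n →₀ ℕ) (a : K) :
    (esymmEquiv K n (monomial s a)).1.IsHomogeneous (∑ i : Fin n, ((i : ℕ) + 1) * s i) := by
  change (esymmAlgHom (Fin n) K n (monomial s a)).1.IsHomogeneous _
  rw [esymmAlgHom_apply, aeval_monomial, Finsupp.prod_fintype _ _ fun i => pow_zero _]
  exact IsHomogeneous.C_mul (IsHomogeneous.prod _ _ _ fun i _ => (isHomogeneous_esymm _ _).pow _) a

/-- Check monomials in the e_i: the constant one is excluded by d ≠ 0, a linear one of degree d is a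
multiple of e_d, and one with at least two factors is decomposable. -/
theorem exists_componentRW_sub_mem (g : MvPolynomial (Fin n) K) {d : ℕ} (hd : d ≠ 0) :
    ∃ c : K, componentRW d (esymmEquiv K n g) - c • esymmRW K n d ∈ augIdeal K n ^ 2 := by
  induction g using MvPolynomial.induction_on' with
  | add p q hp hq =>
    obtain ⟨c, hc⟩ := hp
    obtain ⟨c', hc'⟩ := hq
    refine ⟨c + c', ?_⟩
    have h : componentRW d (esymmEquiv K n (p + q)) =
        componentRW d (esymmEquiv K n p) + componentRW d (esymmEquiv K n q) := by
      rw [map_add]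
      exact Subtype.ext (map_add (homogeneousComponent d) _ _)
    rw [h, add_smul, add_sub_add_comm]
    exact add_mem hc hc'
  | monomial s a =>
    rw [componentRW_of_isHomogeneous (isHomogeneous_esymmEquiv_monomial s a)]
    split_ifs with hds
    swap
    · exact ⟨0, by simp⟩
    have hX : ∀ (s : Fin n →₀ ℕ) (i : Fin n), esymmEquiv K n (monomial (s + Finsupp.single i 1) a) =
        esymmEquiv K n (monomial s a) * esymmRW K n (i + 1) := fun s i => by
      rw [← esymmEquiv_X, ← map_mul, X, monomial_mul, mul_one]
    have hdec : ∀ s : Fin n →₀ ℕ, s ≠ 0 → ∃ t i, s = t + Finsupp.single i 1 := fun s hs => by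
      obtain ⟨i, hi⟩ := Finsupp.ne_iff.1 hs
      refine ⟨s - Finsupp.single i 1, i, (tsub_add_cancel_of_le ?_).symm⟩
      rw [Finsupp.single_le_iff]
      exact Nat.one_le_iff_ne_zero.2 hi
    by_cases hs : s = 0
    · subst hs
      exact absurd (by simpa using hds) hd
    obtain ⟨t, i, rfl⟩ := hdec s hs
    by_cases ht : t = 0
    · subst ht
      refine ⟨a, ?_⟩
      have hdi : d = i + 1 := by
        rw [hds, zero_add, Finset.sum_eq_single i (fun j _ hj => by simp [hj]) (by simp)]
        simp
      have h0 : esymmEquiv K n (monomial 0 a) = algebraMap K (RW K n) a :=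
        (esymmEquiv K n).commutes a
      rw [hX, h0, hdi, ← Algebra.smul_def, sub_self]
      exact zero_mem _
    · obtain ⟨t, j, rfl⟩ := hdec t ht
      refine ⟨0, ?_⟩
      rw [zero_smul, sub_zero, hX, hX, mul_assoc, pow_two]
      exact Ideal.mul_mem_left _ _ (Ideal.mul_mem_mul (esymmRW_mem_augIdeal (Nat.succ_ne_zero _))
        (esymmRW_mem_augIdeal (Nat.succ_ne_zero _)))

theorem toCotangent_mem_span_of_isHomogeneous (f : augIdeal K n) {d : ℕ}
    (hf : f.1.1.IsHomogeneous (d + 1)) :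
    (augIdeal K n).toCotangent f ∈ Submodule.span K {esymmClass K n d} := by
  obtain ⟨c, hc⟩ := exists_componentRW_sub_mem ((esymmEquiv K n).symm f.1) d.succ_ne_zero
  rw [AlgEquiv.apply_symm_apply, componentRW_of_isHomogeneous hf, if_pos rfl] at hc
  have h := toCotangent_eq_smul (f := f)
    (g := ⟨esymmRW K n (d + 1), esymmRW_mem_augIdeal d.succ_ne_zero⟩) hc
  rw [h]
  exact Submodule.smul_mem _ _ (Submodule.mem_span_singleton_self _)

theorem grossPiece_succ (d : ℕ) :
    grossPiece K n (d + 1) = Submodule.span K {esymmClass K n d} := by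
  refine le_antisymm ?_ ?_
  · rintro _ ⟨f, hf, rfl⟩
    exact toCotangent_mem_span_of_isHomogeneous f hf
  · rw [Submodule.span_singleton_le_iff_mem]
    exact ⟨_, isHomogeneous_esymm (K := K) (Fin n) (d + 1), rfl⟩

theorem esymmClass_eq_zero {d : ℕ} (hd : n ≤ d) : esymmClass K n d = 0 := by
  refine (Ideal.toCotangent_eq_zero _ _).2 ?_
  change esymmRW K n (d + 1) ∈ _
  rw [esymmRW_eq_zero (by omega)]
  exact zero_mem _

theorem span_esymmClass :
    Submodule.span K (Set.range fun i : Fin n => esymmClass K n i) = ⊤ := by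
  refine eq_top_iff.2 fun v _ => ?_
  obtain ⟨f, rfl⟩ := (augIdeal K n).toCotangent_surjective v
  have hmem : ∀ d, componentRW d f.1 ∈ augIdeal K n := fun d => by
    rcases Nat.eq_zero_or_pos d with rfl | hd
    · rw [mem_augIdeal]
      change constantCoeff (homogeneousComponent 0 f.1.1) = 0
      rw [homogeneousComponent_zero, constantCoeff_C]
      exact f.2
    · exact mem_augIdeal_of_isHomogeneous hd.ne' (homogeneousComponent_isHomogeneous d f.1.1)
  have hsum : f = ∑ d ∈ Finset.range (f.1.1.totalDegree + 1),
      (⟨componentRW d f.1, hmem d⟩ : augIdeal K n) := by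
    refine Subtype.ext (Subtype.ext ?_)
    rw [AddSubmonoidClass.coe_finsetSum, AddSubmonoidClass.coe_finsetSum]
    exact (sum_homogeneousComponent f.1.1).symm
  rw [hsum, map_sum]
  refine sum_mem fun d _ => ?_
  rcases d with _ | d
  · have h0 : (⟨componentRW 0 f.1, hmem 0⟩ : augIdeal K n) = 0 := by
      refine Subtype.ext (Subtype.ext ?_)
      change homogeneousComponent 0 f.1.1 = 0
      rw [homogeneousComponent_zero, ← constantCoeff_eq, (mem_augIdeal _).1 f.2, C_0]
    rw [h0, map_zero]
    exact zero_mem _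
  · refine (Submodule.span_singleton_le_iff_mem _ _).2 ?_
      (toCotangent_mem_span_of_isHomogeneous _ (homogeneousComponent_isHomogeneous (d + 1) f.1.1))
    by_cases hd : d < n
    · exact Submodule.subset_span ⟨⟨d, hd⟩, rfl⟩
    · rw [esymmClass_eq_zero (not_lt.1 hd)]
      exact zero_mem _

theorem finrank_grossPiece {i : ℕ} (hi : i ∈ Finset.Icc 1 n) :
    Module.finrank K (grossPiece K n i) = 1 := by
  obtain ⟨h1, h2⟩ := Finset.mem_Icc.1 hi
  obtain ⟨d, rfl⟩ := Nat.exists_eq_add_of_le' h1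
  rw [grossPiece_succ]
  exact finrank_span_singleton (linearIndependent_esymmClass.ne_zero (⟨d, h2⟩ : Fin n))

theorem isInternal_grossPiece :
    DirectSum.IsInternal fun i : Finset.Icc 1 n => grossPiece K n (i : ℕ) := by
  have hidx : ∀ i : Finset.Icc 1 n, (i : ℕ) - 1 + 1 = i ∧ (i : ℕ) - 1 < n := fun i => by
    have := Finset.mem_Icc.1 i.2
    omega
  have hpiece : (fun i : Finset.Icc 1 n => grossPiece K n (i : ℕ)) =
      fun i : Finset.Icc 1 n => Submodule.span K {esymmClass K n ((i : ℕ) - 1)} := funext fun i => by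
    rw [← grossPiece_succ, (hidx i).1]
  rw [hpiece]
  refine DirectSum.isInternal_submodule_of_iSupIndep_of_iSup_eq_top ?_ ?_
  · have hinj : Function.Injective fun i : Finset.Icc 1 n => (⟨(i : ℕ) - 1, (hidx i).2⟩ : Fin n) :=
      fun i j hij => Subtype.ext (by
        have := Fin.ext_iff.1 hij
        have h1 := hidx i
        have h2 := hidx j
        dsimp only at this
        omega)
    exact (linearIndependent_esymmClass.comp _ hinj).iSupIndep_span_singleton
  · rw [eq_top_iff, ← span_esymmClass, Submodule.span_le]
    rintro _ ⟨i, rfl⟩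
    refine Submodule.mem_iSup_of_mem ⟨i + 1, Finset.mem_Icc.2 ⟨by omega, i.2⟩⟩ ?_
    exact Submodule.mem_span_singleton_self _

/-! ### Complete symmetric polynomials and power sums modulo decomposables. -/

theorem hseq_add (m : ℕ) : hseq K n (m + n) =
    ∑ j : Fin n, (-1) ^ (j.rev : ℕ) * esymmRW K n (j.rev + 1) * hseq K n (m + j) :=
  hseq_isSolution m

theorem hseq_mem_augIdeal {m : ℕ} (hm : n ≤ m) : hseq K n m ∈ augIdeal K n := by
  obtain ⟨m, rfl⟩ := Nat.exists_eq_add_of_le' hm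
  rw [hseq_add]
  exact Ideal.sum_mem _ fun j _ => Ideal.mul_mem_right _ _
    (Ideal.mul_mem_left _ _ (esymmRW_mem_augIdeal (Nat.succ_ne_zero _)))

/-- Modulo decomposables, the complete symmetric polynomial `h_i` is `(-1)^{i - 1} e_i`. -/
theorem hseq_sub_mem {d : ℕ} (hd : d < n) :
    hseq K n (d + n) - (-1) ^ d * esymmRW K n (d + 1) ∈ augIdeal K n ^ 2 := by
  -- The index with d + j₀ = n - 1, where H is 1. For smaller j the factor H vanishes; for larger j
  -- it lies in the augmentation ideal, as does its coefficient.
  set j₀ : Fin n := (⟨d, hd⟩ : Fin n).rev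
  have hj₀ : (j₀.rev : ℕ) = d := by simp [j₀]
  have hj₀' : (j₀ : ℕ) = n - (d + 1) := Fin.val_rev _
  rw [hseq_add, ← Finset.add_sum_erase _ _ (Finset.mem_univ j₀), hj₀,
    hseq_eq_one (m := d + j₀) (by omega), mul_one, add_sub_cancel_left]
  refine Ideal.sum_mem _ fun j hj => ?_
  have hne : (j : ℕ) ≠ j₀ := fun h => (Finset.ne_of_mem_erase hj) (Fin.ext h)
  by_cases h : d + j + 1 < n
  · rw [hseq_eq_zero h, mul_zero]
    exact zero_mem _
  · rw [pow_two]
    exact Ideal.mul_mem_mul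
      (Ideal.mul_mem_left _ _ (esymmRW_mem_augIdeal (Nat.succ_ne_zero _)))
      (hseq_mem_augIdeal (by omega))

/-- The power sum `p_i` as an element of `R^W`. -/
def psumRW (K : Type*) [Field K] (n : ℕ) (i : ℕ) : RW K n :=
  ⟨psum (Fin n) K i, psum_isSymmetric _ _ _⟩

theorem psumRW_mem_augIdeal {i : ℕ} (hi : i ≠ 0) : psumRW K n i ∈ augIdeal K n :=
  mem_augIdeal_of_isHomogeneous hi (isHomogeneous_psum _ _)

/-- Newton's identity modulo decomposables. -/
theorem psumRW_sub_mem (d : ℕ) :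
    psumRW K n (d + 1) - (-1) ^ d * (d + 1) * esymmRW K n (d + 1) ∈ augIdeal K n ^ 2 := by
  have h : psumRW K n (d + 1) - (-1) ^ d * (d + 1) * esymmRW K n (d + 1) =
      -∑ a ∈ Finset.HasAntidiagonal.antidiagonal (d + 1) with a.1 ∈ Set.Ioo 0 (d + 1),
        (-1) ^ a.1 * esymmRW K n a.1 * psumRW K n a.2 := by
    refine Subtype.ext ?_
    have h1 := psum_eq_mul_esymm_sub_sum (Fin n) K (d + 1) d.succ_pos
    change psum (Fin n) K (d + 1) - (-1) ^ d * ((d : MvPolynomial (Fin n) K) + 1) *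
      esymm (Fin n) K (d + 1) = -(∑ a ∈ Finset.HasAntidiagonal.antidiagonal (d + 1) with a.1 ∈ Set.Ioo 0 (d + 1),
        (-1) ^ a.1 * esymmRW K n a.1 * psumRW K n a.2 : RW K n).1
    rw [AddSubmonoidClass.coe_finsetSum, h1]
    change _ = -∑ a ∈ Finset.HasAntidiagonal.antidiagonal (d + 1) with a.1 ∈ Set.Ioo 0 (d + 1),
        (-1) ^ a.1 * esymm (Fin n) K a.1 * psum (Fin n) K a.2
    push_cast
    ring
  rw [h]
  refine neg_mem (Ideal.sum_mem _ fun a ha => ?_)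
  obtain ⟨ha1, ha2⟩ := Finset.mem_filter.1 ha
  have ha3 := Finset.HasAntidiagonal.mem_antidiagonal.1 ha1
  obtain ⟨h1, h2⟩ := ha2
  rw [pow_two]
  exact Ideal.mul_mem_mul (Ideal.mul_mem_left _ _ (esymmRW_mem_augIdeal (by omega)))
    (psumRW_mem_augIdeal (by omega))

/-- The signs (-1)^d in Newton's identity and in h_{d+1} ≡ (-1)^d e_{d+1} cancel. -/
theorem mk_psumRW {d : ℕ} (hd : d < n) :
    Ideal.Quotient.mk (augIdeal K n ^ 2) (psumRW K n (d + 1)) =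
      ((d + 1 : ℕ) : RW K n ⧸ augIdeal K n ^ 2) *
        Ideal.Quotient.mk (augIdeal K n ^ 2) (hseq K n (d + n)) := by
  have h : Ideal.Quotient.mk (augIdeal K n ^ 2) (psumRW K n (d + 1)) =
      Ideal.Quotient.mk (augIdeal K n ^ 2) (((d + 1 : ℕ) : RW K n) * hseq K n (d + n)) := by
    refine Ideal.Quotient.eq.2 ?_
    convert Ideal.sub_mem _ (psumRW_sub_mem (K := K) (n := n) d)
      (Ideal.mul_mem_left _ ((d + 1 : ℕ) : RW K n) (hseq_sub_mem hd)) using 1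
    push_cast
    ring
  rw [h, map_mul, map_natCast]

/-- If an index is below k + 1 the product is zero; if both exceed it the product is decomposable.
Otherwise one factor is 1 and the index sum determines the other. -/
theorem mk_hseq_mul_hseq {k a b d : ℕ} (h : a + b = 2 * (k + 1) + (d + 1)) :
    Ideal.Quotient.mk (augIdeal K (k + 2) ^ 2) (hseq K (k + 2) a * hseq K (k + 2) b) =
      ((if a = k + 1 then 1 else 0) + (if b = k + 1 then 1 else 0)) *
        Ideal.Quotient.mk (augIdeal K (k + 2) ^ 2) (hseq K (k + 2) (d + (k + 2))) := by
  rcases lt_trichotomy a (k + 1) with ha | rfl | ha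
  · rw [hseq_eq_zero (m := a) (by omega), if_neg (by omega), if_neg (by omega)]
    simp
  · rw [hseq_eq_one rfl, if_pos rfl, if_neg (by omega), one_mul, add_zero, one_mul,
      show b = d + (k + 2) by omega]
  · rcases lt_trichotomy b (k + 1) with hb | rfl | hb
    · rw [hseq_eq_zero (m := b) (by omega), if_neg (by omega), if_neg (by omega)]
      simp
    · rw [hseq_eq_one (m := k + 1) rfl, if_pos rfl, if_neg (by omega), mul_one, zero_add, one_mul,
        show a = d + (k + 2) by omega]
    · rw [if_neg (by omega), if_neg (by omega), add_zero, zero_mul, Ideal.Quotient.eq_zero_iff_mem,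
        pow_two]
      exact Ideal.mul_mem_mul (hseq_mem_augIdeal (by omega)) (hseq_mem_augIdeal (by omega))

/-! ### The derivation on power sums. -/

theorem pderivCoweight_psum (k d : ℕ) :
    pderivCoweight (coweightTwo (k + 2)) (psum (Fin (k + 2)) K (d + 1)) =
      ((d + 1 : ℕ) : MvPolynomial (Fin (k + 2)) K) * (X 0 ^ d + X 1 ^ d) := by
  have hX : ∀ j, pderivCoweight (K := K) (coweightTwo (k + 2)) (X j) =
      C (coweightTwo (k + 2) j : K) := fun j => by simp [pderivCoweight]
  have h0 : coweightTwo (k + 2) 0 = 1 := rfl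
  have h1 : coweightTwo (k + 2) 1 = 1 := rfl
  have h2 : ∀ i : Fin k, coweightTwo (k + 2) i.succ.succ = 0 := fun i => rfl
  rw [psum, map_sum, Fin.sum_univ_succ, Fin.sum_univ_succ]
  simp only [Derivation.leibniz_pow, hX, Fin.succ_zero_eq_one, h0, h1, h2, Int.cast_one,
    Int.cast_zero, map_one, map_zero, mul_zero, Finset.sum_const_zero, add_zero,
    Nat.add_sub_cancel, smul_eq_mul, mul_one, nsmul_eq_mul]
  ring

/-- Expanding the second copy as (y + x)^N pairs each monomial with its mirror image, so that every
summand is x - y times a symmetric polynomial. -/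
theorem mul_add_pow_mul {R : Type*} [CommRing R] (x y c : R) (N d : ℕ) :
    (x - y) * ((x + y) ^ N * (c * (x ^ d + y ^ d))) = ∑ l ∈ Finset.range (N + 1),
      c * (N.choose l) * (x - y) * (x ^ l * y ^ (N - l) * x ^ d + y ^ l * x ^ (N - l) * y ^ d) := by
  have h1 := add_pow x y N
  have h2 := add_pow y x N
  have h3 : (x - y) * ((x + y) ^ N * (c * (x ^ d + y ^ d))) =
      c * (x - y) * (x + y) ^ N * x ^ d + c * (x - y) * (y + x) ^ N * y ^ d := by
    rw [add_comm y x]; ring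
  rw [h3, h1, h2, Finset.mul_sum, Finset.mul_sum, Finset.sum_mul, Finset.sum_mul,
    ← Finset.sum_add_distrib]
  exact Finset.sum_congr rfl fun l _ => by ring

theorem etaTwo_mul_pderivRW_psumRW [CharZero K] {k : ℕ} (hk : 1 ≤ k) (d : ℕ) :
    etaTwo K (k + 2) (by omega) * pderivRW (coweightTwo (k + 2)) (psumRW K (k + 2) (d + 1)) =
      ∑ l ∈ Finset.range (2 * k + 2), (((d + 1) * (2 * k + 1).choose l : ℕ) : RW K (k + 2)) •
        (schurTwo (K := K) hk (l + d + 1) (2 * k + 1 - l) +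
          schurTwo hk (2 * k + 1 - l + 1) (l + d)) := by
  refine ext_of_mul ?_
  have hsmul : ∀ (m : ℕ) (s t : RWμ K (coweightTwo (k + 2))),
      ((m : RW K (k + 2)) • (s + t)).1 = (m : MvPolynomial (Fin (k + 2)) K) * (s.1 + t.1) :=
    fun m s t => by
      have h : (m : MvPolynomial (Fin (k + 2)) K) = (m : RW K (k + 2)).1 :=
        (map_natCast (RW K (k + 2)).val m).symm
      rw [h]
      rfl
  rw [AddSubmonoidClass.coe_finsetSum, Finset.mul_sum]
  simp only [hsmul]
  have hlhs : (etaTwo K (k + 2) (by omega) *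
      pderivRW (coweightTwo (k + 2)) (psumRW K (k + 2) (d + 1))).1 = (X 0 + X 1) ^ (2 * k + 1) *
      pderivCoweight (coweightTwo (k + 2)) (psum (Fin (k + 2)) K (d + 1)) := rfl
  rw [hlhs, pderivCoweight_psum, mul_add_pow_mul]
  refine Finset.sum_congr rfl fun l _ => ?_
  generalize 2 * k + 1 - l = r
  push_cast
  linear_combination -((d + 1) * ((2 * k + 1).choose l : MvPolynomial (Fin (k + 2)) K)) *
    (mul_schurTwo (K := K) hk (l + d + 1) r + mul_schurTwo (K := K) hk (r + 1) (l + d))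

/-- The coefficient of the eigenvalue contributed by the `l`-th term of the binomial expansion. -/
def eigenweightTerm (k d l : ℕ) : ℤ :=
  2 * ((if l + (d + 1) = k + 1 then 1 else 0) + if l + 0 = k + 1 then 1 else 0) -
    ((if l + 0 = k then 1 else 0) + if l + (d + 2) = k + 1 then 1 else 0) -
    ((if l + d = k + 1 then 1 else 0) + if l + 0 = k + 2 then 1 else 0)

/-- With r = 2k + 1 - l, the l-th pair of Schur terms integrates to 2 H(l+d+1) H(r+1) - H(r)
H(l+d+2) - H(l+d) H(r+2). Every product here has index sum 2(k+1) + (d+1), so `mk_hseq_mul_hseq`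
applies. -/
theorem mk_nabla_psumRW [CharZero K] {k d : ℕ} (hk : 1 ≤ k) (hd : d < k + 2) :
    Ideal.Quotient.mk (augIdeal K (k + 2) ^ 2)
      (nabla (coweightTwo (k + 2)) (etaTwo K (k + 2) (by omega)) (psumRW K (k + 2) (d + 1))) =
    ((∑ l ∈ Finset.range (2 * k + 2), ((2 * k + 1).choose l : ℤ) * eigenweightTerm k d l : ℤ) :
      RW K (k + 2) ⧸ augIdeal K (k + 2) ^ 2) *
      Ideal.Quotient.mk (augIdeal K (k + 2) ^ 2) (psumRW K (k + 2) (d + 1)) := by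
  have hI := isFibreIntegral_fibreIntegral (K := K) hk
  rw [nabla_apply, etaTwo_mul_pderivRW_psumRW hk, map_sum, map_sum, mk_psumRW hd, Int.cast_sum,
    Finset.sum_mul]
  refine Finset.sum_congr rfl fun l hl => ?_
  have hl' : l < 2 * k + 2 := Finset.mem_range.1 hl
  rw [map_smul, map_add, fibreIntegral_schurTwo hk hI, fibreIntegral_schurTwo hk hI, smul_eq_mul]
  simp only [map_mul, map_add, map_sub, map_natCast]
  simp only [← map_mul (Ideal.Quotient.mk (augIdeal K (k + 2) ^ 2))]
  rw [mk_hseq_mul_hseq (d := d) (by omega), mk_hseq_mul_hseq (d := d) (by omega),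
    mk_hseq_mul_hseq (d := d) (by omega), mk_hseq_mul_hseq (d := d) (by omega)]
  have e1 : (l + d + 1 = k + 1) ↔ l + (d + 1) = k + 1 := by omega
  have e2 : (2 * k + 1 - l + 1 = k + 1) ↔ l + 0 = k + 1 := by omega
  have e3 : (2 * k + 1 - l = k + 1) ↔ l + 0 = k := by omega
  have e4 : (l + d + 1 + 1 = k + 1) ↔ l + (d + 2) = k + 1 := by omega
  have e5 : (2 * k + 1 - l + 1 + 1 = k + 1) ↔ l + 0 = k + 2 := by omega
  simp only [e1, e2, e3, e4, e5, eigenweightTerm]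
  push_cast
  ring

/-! ### Evaluation of the binomial sum and the eigenweights. -/

theorem sum_choose_mul_ite (N c m : ℕ) :
    ∑ l ∈ Finset.range (N + 1), ((N.choose l : ℚ) * if l + c = m then 1 else 0) =
      binom N ((m : ℤ) - c) := by
  simp only [mul_ite, mul_one, mul_zero]
  rw [binom]
  split_ifs with h
  · have hc : c ≤ m := by omega
    have ht : ((m : ℤ) - c).toNat = m - c := by omega
    have he : ∀ l, l + c = m ↔ m - c = l := fun l => by omega
    simp only [he, Finset.sum_ite_eq, Finset.mem_range, ht]
    split_ifs with hN
    · rfl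
    · rw [Nat.choose_eq_zero_of_lt (by omega), Nat.cast_zero]
  · exact Finset.sum_eq_zero fun l _ => if_neg (by omega)

/-- The terms independent of d are 2 C(2k+1, k+1) - C(2k+1, k) - C(2k+1, k+2) = C(2k+1, k+1) -
C(2k+1, k+2), the Catalan number C(2n-2, n-1)/n. The others are the three binomials depending on i =
d + 1. -/
theorem sum_eigenweightTerm (k d : ℕ) :
    ((∑ l ∈ Finset.range (2 * k + 2), ((2 * k + 1).choose l : ℤ) * eigenweightTerm k d l : ℤ) : ℚ) =
      eigenweightTwo (k + 2) (d + 1) := by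
  have hterm : ∀ l, ((((2 * k + 1).choose l : ℤ) * eigenweightTerm k d l : ℤ) : ℚ) =
      2 * (((2 * k + 1).choose l : ℚ) * if l + (d + 1) = k + 1 then 1 else 0) +
      2 * (((2 * k + 1).choose l : ℚ) * if l + 0 = k + 1 then 1 else 0) -
      (((2 * k + 1).choose l : ℚ) * if l + 0 = k then 1 else 0) -
      (((2 * k + 1).choose l : ℚ) * if l + (d + 2) = k + 1 then 1 else 0) -
      (((2 * k + 1).choose l : ℚ) * if l + d = k + 1 then 1 else 0) -
      (((2 * k + 1).choose l : ℚ) * if l + 0 = k + 2 then 1 else 0) := fun l => by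
    rw [eigenweightTerm]
    push_cast
    ring
  rw [Int.cast_sum]
  simp only [hterm, Finset.sum_sub_distrib, Finset.sum_add_distrib, ← Finset.mul_sum,
    sum_choose_mul_ite]
  have hN : ∀ m : ℕ, binom (2 * k + 1) ((m : ℤ) - ((0 : ℕ) : ℤ)) = (2 * k + 1).choose m :=
    fun m => by simp [binom]
  rw [hN, hN, hN, eigenweightTwo]
  have h1 : 2 * (k + 2) - 2 = 2 * k + 1 + 1 := by omega
  have h2 : 2 * (k + 2) - 3 = 2 * k + 1 := by omega
  have h4 : binom (2 * k + 1 + 1) (((k + 2 : ℕ) : ℤ) - 1) =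
      (2 * k + 1).choose k + (2 * k + 1).choose (k + 1) := by
    rw [← Nat.cast_add, ← Nat.choose_succ_succ, binom, if_pos (by omega)]
    congr 2
    omega
  have h5 : ((k + 2 : ℕ) : ℤ) - ((d + 1 : ℕ) : ℤ) = ((k + 1 : ℕ) : ℤ) - (d : ℤ) := by
    push_cast; ring
  have h6 : ((k + 1 : ℕ) : ℤ) - (d : ℤ) - 1 = ((k + 1 : ℕ) : ℤ) - ((d + 1 : ℕ) : ℤ) := by
    push_cast; ring
  have h7 : ((k + 1 : ℕ) : ℤ) - (d : ℤ) - 2 = ((k + 1 : ℕ) : ℤ) - ((d + 2 : ℕ) : ℤ) := by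
    push_cast; ring
  rw [h1, h2, h4, h5, h6, h7]
  have hsymm : (2 * k + 1).choose k = (2 * k + 1).choose (k + 1) :=
    Nat.choose_symm_of_eq_add (by omega)
  have hsucc : ((2 * k + 1).choose (k + 2) : ℚ) * (k + 2) = (2 * k + 1).choose (k + 1) * k := by
    have h := Nat.choose_succ_right_eq (2 * k + 1) (k + 1)
    rw [show 2 * k + 1 - (k + 1) = k by omega] at h
    exact_mod_cast h
  have hk0 : (k : ℚ) + 2 ≠ 0 := by positivity
  rw [hsymm]
  push_cast
  have hmain : 1 / ((k : ℚ) + 2) * ((2 * k + 1).choose (k + 1) + (2 * k + 1).choose (k + 1)) =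
      (2 * k + 1).choose (k + 1) - (2 * k + 1).choose (k + 2) := by
    field_simp
    linear_combination hsucc
  rw [hmain]
  ring

/-- The class of p_{d+1} is an eigenvector and equals (-1)^d (d + 1) times that of e_{d+1}, a
nonzero scalar in characteristic 0. -/
theorem nablaBar_esymmClass [CharZero K] {k d : ℕ} (hk : 1 ≤ k) (hd : d < k + 2) :
    nablaBar (coweightTwo (k + 2)) (etaTwo K (k + 2) (by omega))
        (etaTwo_isHomogeneous (k + 2) (by omega)) (esymmClass K (k + 2) d) =
      (eigenweightTwo (k + 2) (d + 1) : K) • esymmClass K (k + 2) d := by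
  set Z : ℤ := ∑ l ∈ Finset.range (2 * k + 2), ((2 * k + 1).choose l : ℤ) * eigenweightTerm k d l
  -- The eigenweight is an integer, so its cast from ℚ to K can be computed through ℤ.
  have hZ : (eigenweightTwo (k + 2) (d + 1) : K) = (Z : K) := by
    rw [← sum_eigenweightTerm, Rat.cast_intCast]
  set p : augIdeal K (k + 2) := ⟨psumRW K (k + 2) (d + 1), psumRW_mem_augIdeal d.succ_ne_zero⟩
  have hp : (augIdeal K (k + 2)).toCotangent p =
      ((-1) ^ d * (d + 1) : K) • esymmClass K (k + 2) d := by
    refine toCotangent_eq_smul ?_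
    convert psumRW_sub_mem (K := K) (n := k + 2) d using 2
    rw [Algebra.smul_def]
    simp only [map_mul, map_pow, map_neg, map_one, map_add, map_natCast]
  have hne : ((-1) ^ d * (d + 1) : K) ≠ 0 :=
    mul_ne_zero (pow_ne_zero _ (neg_ne_zero.2 one_ne_zero)) (Nat.cast_add_one_ne_zero d)
  have hmain : nablaBar (coweightTwo (k + 2)) (etaTwo K (k + 2) (by omega))
      (etaTwo_isHomogeneous (k + 2) (by omega)) ((augIdeal K (k + 2)).toCotangent p) =
      (Z : K) • (augIdeal K (k + 2)).toCotangent p := by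
    rw [nablaBar_toCotangent]
    refine toCotangent_eq_smul ?_
    rw [← Ideal.Quotient.eq_zero_iff_mem, map_sub, mk_nabla_psumRW hk hd, sub_eq_zero,
      Algebra.smul_def, map_mul, map_intCast, map_intCast]
  rw [hp, map_smul, smul_comm] at hmain
  rw [hZ]
  exact smul_right_injective _ hne hmain

end GLEigenweight

end


open GLEigenweight
theorem mainTheorem12 {K : Type*} [Field K] [CharZero K] (n : ℕ) (hn : 3 ≤ n) :
    (∃! I : RWμ K (coweightTwo n) →ₗ[RW K n] RW K n, IsFibreIntegral (coweightTwo n) I) ∧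
    DirectSum.IsInternal (fun i : Finset.Icc 1 n => grossPiece K n (i : ℕ)) ∧
    ∀ i ∈ Finset.Icc 1 n,
      Module.finrank K (grossPiece K n i) = 1 ∧
      ∀ v ∈ grossPiece K n i,
        nablaBar (coweightTwo n) (etaTwo K n hn) (etaTwo_isHomogeneous n hn) v =
          (eigenweightTwo n i : K) • v := by
  obtain ⟨k, rfl⟩ := Nat.exists_eq_add_of_le' (show 2 ≤ n by omega)
  have hk : 1 ≤ k := by omega
  refine ⟨existsUnique_isFibreIntegral hk, isInternal_grossPiece, fun i hi =>
    ⟨finrank_grossPiece hi, fun v hv => ?_⟩⟩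
  obtain ⟨h1, h2⟩ := Finset.mem_Icc.1 hi
  obtain ⟨d, rfl⟩ := Nat.exists_eq_add_of_le' h1
  rw [grossPiece_succ] at hv
  obtain ⟨c, rfl⟩ := Submodule.mem_span_singleton.1 hv
  rw [map_smul, nablaBar_esymmClass hk h2, smul_comm]
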